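/- Let $K$ be a number field with algebraic closure $\overline K$, let $a,c\in K$, and let $\phi_t(x)=\dfrac{x^2+tx}{cx+1}$. For an integer $N\ge 1$ let $Y^{\mathrm{pre}}(N)\subset\mathbb A^2$ (coordinates $x,t$) be the algebraic set defined by the equation $\phi_t^N(x)-a=0$ after clearing denominators, where $\phi_t^N$ is the $N$-th iterate of $\phi_t$, and let $Y^{\mathrm{pre}}(N,1),\dots,Y^{\mathrm{pre}}(N,r_N)$ be its irreducible components over $\overline K$. For each $i$, let $\deg_x Y^{\mathrm{pre}}(N,i)$ be the degree in $x$ of the equation defining $Y^{\mathrm{pre}}(N,i)$ in $\mathbb A^2$, and let $L\subset\overline K$ be the minimal field of definition of $Y^{\mathrm{pre}}(N,i)$, that is, the smallest subfield of $\overline K$ such that the ideal of $Y^{\mathrm{pre}}(N,i)$ is generated by polynomials with coefficients in it. The points at infinity of $Y^{\mathrm{pre}}(N,i)$ are the points of $X\setminus Y'$, where $Y'$ is the normalization of $Y^{\mathrm{pre}}(N,i)$ and $X$ is the smooth completion of $Y'$. Then for every $N\ge 1$ and every $i\in\{1,\dots,r_N\}$, the curve $Y^{\mathrm{pre}}(N,i)$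 has at least $\log_2 \deg_x Y^{\mathrm{pre}}(N,i)$ $\mathrm{Gal}(\overline L/L)$-orbits of points at infinity. -/

import Mathlib

namespace PreimageCurves

open MvPolynomial

/-- The polynomial ring `k[x, t]`; the variable `0` is `x` and the variable `1` is `t`. -/
abbrev PlanePoly (k : Type*) [Field k] : Type _ := MvPolynomial (Fin 2) k

/-- The rational map `φ_t(f) = (f ^ 2 + t f) / (c f + 1)`, on the field `k(x, t)`. -/
noncomputable def phi {k : Type*} [Field k] (c : k) (f : FractionRing (PlanePoly k)) :
    FractionRing (PlanePoly k) :=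
  (f ^ 2 + algebraMap (PlanePoly k) _ (X 1) * f) / (algebraMap (PlanePoly k) _ (C c) * f + 1)

/-- The pair `(P_N, Q_N)` of numerator and denominator of the `N`-th iterate `φ_t^N(x)`. That
`φ_t^N(x) = P_N / Q_N` is proved in `phi_iterate`, and that this fraction is in lowest terms in
`isRelPrime_iteratePair`. -/
noncomputable def iteratePair {k : Type*} [Field k] (c : k) : ℕ → PlanePoly k × PlanePoly k
  | 0 => (X 0, 1)
  | N + 1 =>
    ((iteratePair c N).1 ^ 2 + X 1 * (iteratePair c N).1 * (iteratePair c N).2,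
      C c * (iteratePair c N).1 * (iteratePair c N).2 + (iteratePair c N).2 ^ 2)

theorem eval_iteratePair {k : Type*} [Field k] (c s : k) (N : ℕ) :
    eval ![0, s] (iteratePair c N).1 = 0 ∧ eval ![0, s] (iteratePair c N).2 = 1 := by
  induction N with
  | zero => simp [iteratePair]
  | succ N ih => simp only [iteratePair, map_add, map_mul, map_pow, ih.1, ih.2]; simp

theorem iteratePair_snd_ne_zero {k : Type*} [Field k] (c : k) (N : ℕ) :
    (iteratePair c N).2 ≠ 0 := by
  intro h0
  have := (eval_iteratePair c 0 N).2
  rw [h0] at this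
  simp at this

theorem phi_iterate {k : Type*} [Field k] (c : k) (N : ℕ) :
    (phi c)^[N] (algebraMap (PlanePoly k) _ (X 0)) =
      algebraMap (PlanePoly k) (FractionRing (PlanePoly k)) (iteratePair c N).1 /
        algebraMap (PlanePoly k) (FractionRing (PlanePoly k)) (iteratePair c N).2 := by
  induction N with
  | zero => simp [iteratePair]
  | succ N ih =>
    have hinj := IsFractionRing.injective (PlanePoly k) (FractionRing (PlanePoly k))
    have h1 : algebraMap (PlanePoly k) (FractionRing (PlanePoly k)) (iteratePair c N).2 ≠ 0 := by
      rw [Ne, map_eq_zero_iff _ hinj]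
      exact iteratePair_snd_ne_zero c N
    have h2 : algebraMap (PlanePoly k) (FractionRing (PlanePoly k))
        (iteratePair c (N + 1)).2 ≠ 0 := by
      rw [Ne, map_eq_zero_iff _ hinj]
      exact iteratePair_snd_ne_zero c (N + 1)
    rw [Function.iterate_succ_apply', ih, phi]
    simp only [iteratePair, map_add, map_mul, map_pow] at h2 ⊢
    generalize algebraMap (PlanePoly k) (FractionRing (PlanePoly k)) (iteratePair c N).1 = p at *
    generalize algebraMap (PlanePoly k) (FractionRing (PlanePoly k)) (iteratePair c N).2 = q at *
    generalize algebraMap (PlanePoly k) (FractionRing (PlanePoly k)) (C c) = c' at *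
    generalize algebraMap (PlanePoly k) (FractionRing (PlanePoly k)) (X 1) = t at *
    have h3 : c' * p + q ≠ 0 := by
      intro h
      apply h2
      linear_combination q * h
    have h4 : c' * (p / q) + 1 = (c' * p + q) / q := by field_simp
    rw [h4, div_div_eq_mul_div, div_eq_div_iff h3 h2]
    field_simp
    try ring

theorem isRelPrime_iteratePair {k : Type*} [Field k] (c : k) (N : ℕ) :
    IsRelPrime (iteratePair c N).1 (iteratePair c N).2 := by
  induction N with
  | zero =>
    simp only [iteratePair]
    exact fun d _ h => isUnit_of_dvd_one h
  | succ N ih =>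
    refine WfDvdMonoid.isRelPrime_of_no_irreducible_factors
      (fun h => iteratePair_snd_ne_zero c (N + 1) h.2) fun p hpi hp hq => ?_
    have hpr : Prime p := UniqueFactorizationMonoid.irreducible_iff_prime.1 hpi
    replace ih : ∀ {d : PlanePoly k}, d ∣ (iteratePair c N).1 → d ∣ (iteratePair c N).2 →
        ¬ Prime d := fun h h' hd => hd.not_isUnit (ih h h')
    have hev := fun s => eval_iteratePair c s N
    simp only [iteratePair] at hp hq
    generalize (iteratePair c N).1 = P at ih hp hq hev
    generalize (iteratePair c N).2 = Q at ih hp hq hev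
    have hp' : p ∣ P * (P + X 1 * Q) := by convert hp using 1; ring
    have hq' : p ∣ Q * (C c * P + Q) := by convert hq using 1; ring
    rcases hpr.dvd_or_dvd hp' with h1 | h1
    · refine ih h1 ?_ hpr
      rcases hpr.dvd_or_dvd hq' with h2 | h2
      · exact h2
      · exact (dvd_add_right (h1.mul_left _)).1 h2
    rcases hpr.dvd_or_dvd hq' with h2 | h2
    · exact ih ((dvd_add_left (h2.mul_left _)).1 h1) h2 hpr
    have h3 : p ∣ (C (-c) * X 1 + 1) * Q := by
      convert dvd_sub h2 (h1.mul_left (C c)) using 1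
      rw [C_neg]; ring
    have h4 : p ∣ (C (-c) * X 1 + 1) * P := by
      convert dvd_sub h1 (h2.mul_left (X 1)) using 1
      rw [C_neg]; ring
    have h5 : p ∣ C (-c) * X 1 + 1 := by
      rcases hpr.dvd_or_dvd h3 with h | h
      · exact h
      rcases hpr.dvd_or_dvd h4 with h' | h'
      · exact h'
      exact (ih h' h hpr).elim
    by_cases hc : c = 0
    · subst hc
      rw [neg_zero, map_zero, zero_mul, zero_add] at h5
      exact hpr.not_isUnit (isUnit_of_dvd_one h5)
    have hirr : Irreducible (C (-c) * X 1 + 1 : PlanePoly k) :=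
      irreducible_mul_X_add _ _ _ (by simpa using hc) (by simp) (by simp) isRelPrime_one_right
    obtain ⟨r, hr⟩ := (hpr.irreducible.dvd_symm hirr h5).trans h1
    have := congrArg (eval ![0, c⁻¹]) hr
    simp [(hev c⁻¹).1, (hev c⁻¹).2, hc] at this

/-- The preimage curve of level `N`: the algebraic set in the affine plane over `k` given by
`φ_t^N(x) - a = 0` after clearing denominators, that is, by `P_N - a Q_N = 0`. -/
def Ypre {k : Type*} [Field k] (a c : k) (N : ℕ) : Set (Fin 2 → k) :=
  zeroLocus k (Ideal.span {(iteratePair c N).1 - C a * (iteratePair c N).2})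

/-- An irreducible algebraic subset of the affine plane over `k`. -/
structure IrredPlaneSet (k : Type*) [Field k] where
  carrier : Set (Fin 2 → k)
  isAlgebraic : zeroLocus k (vanishingIdeal k carrier) = carrier
  isPrime : (vanishingIdeal k carrier).IsPrime

namespace IrredPlaneSet

variable {k : Type*} [Field k]

/-- The ideal of all polynomials that vanish on `Y`. -/
noncomputable abbrev ideal (Y : IrredPlaneSet k) : Ideal (PlanePoly k) :=
  vanishingIdeal k Y.carrier

instance (Y : IrredPlaneSet k) : Y.ideal.IsPrime := Y.isPrime

/-- `Y` is an irreducible component of `Z`: a maximal irreducible algebraic subset of `Z`. -/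
def IsComponentOf (Y : IrredPlaneSet k) (Z : Set (Fin 2 → k)) : Prop :=
  Y.carrier ⊆ Z ∧
    ∀ W : IrredPlaneSet k, W.carrier ⊆ Z → Y.carrier ⊆ W.carrier → W.carrier ⊆ Y.carrier

/-- `Y` is defined over the subfield `M`: its ideal is generated by polynomials with coefficients
in `M`. -/
def IsDefinedOver (Y : IrredPlaneSet k) (M : Subfield k) : Prop :=
  ∃ J : Ideal (MvPolynomial (Fin 2) M), Y.ideal = J.map (MvPolynomial.map M.subtype)

/-- The coordinate ring `k[Y]`. -/
abbrev CoordinateRing (Y : IrredPlaneSet k) : Type _ := PlanePoly k ⧸ Y.ideal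

/-- The function field `k(Y)`. -/
abbrev FunctionField (Y : IrredPlaneSet k) : Type _ := FractionRing Y.CoordinateRing

/-- A coordinate function of the plane (`x` for `0`, `t` for `1`) as a rational function on `Y`. -/
noncomputable def coord (Y : IrredPlaneSet k) (i : Fin 2) : Y.FunctionField :=
  algebraMap Y.CoordinateRing Y.FunctionField (Ideal.Quotient.mk Y.ideal (X i))

/-- The points at infinity of the curve `Y`. The points of the smooth completion of the
normalization of `Y` are the proper valuation rings of `k(Y)` that contain the constants `k`, and
such a point lies on the (affine) normalization of `Y` itself exactly when its valuation ring
contains the coordinate ring `k[Y]`. -/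
def PointAtInfinity (Y : IrredPlaneSet k) : Type _ :=
  {V : ValuationSubring Y.FunctionField //
    (∀ z : k, algebraMap k Y.FunctionField z ∈ V) ∧
      ¬ ∀ f : Y.CoordinateRing, algebraMap Y.CoordinateRing Y.FunctionField f ∈ V}

/-- The field automorphism `τ` of `k(Y)` is the action of the automorphism `σ` of `k` on the
coefficients: it extends `σ` and fixes `x` and `t`. There is exactly one such `τ` when `Y` is
defined over a field that `σ` fixes. -/
def IsCoefficientAction (Y : IrredPlaneSet k) (σ : k ≃+* k)
    (τ : Y.FunctionField ≃+* Y.FunctionField) : Prop :=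
  (∀ z : k, τ (algebraMap k Y.FunctionField z) = algebraMap k Y.FunctionField (σ z)) ∧
    ∀ i, τ (Y.coord i) = Y.coord i

/-- Two points at infinity of `Y` are conjugate over `M` if an element of the group of
automorphisms of `k` over `M` carries the first to the second. -/
def infinitySetoid (Y : IrredPlaneSet k) (M : Subfield k) : Setoid Y.PointAtInfinity where
  r P Q := ∃ (σ : k ≃ₐ[M] k) (τ : Y.FunctionField ≃+* Y.FunctionField),
    Y.IsCoefficientAction σ.toRingEquiv τ ∧ ∀ f, τ f ∈ Q.1 ↔ f ∈ P.1
  iseqv :=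
    { refl := fun P => ⟨AlgEquiv.refl, RingEquiv.refl _, ⟨fun _ => rfl, fun _ => rfl⟩,
        fun _ => Iff.rfl⟩
      symm := by
        rintro P Q ⟨σ, τ, ⟨h1, h2⟩, h3⟩
        refine ⟨σ.symm, τ.symm, ⟨fun z => ?_, fun i => ?_⟩, fun f => ?_⟩
        · rw [RingEquiv.symm_apply_eq, h1]
          exact congrArg _ (σ.apply_symm_apply z).symm
        · rw [RingEquiv.symm_apply_eq, h2]
        · rw [← h3, RingEquiv.apply_symm_apply]
      trans := by
        rintro P Q R ⟨σ, τ, ⟨h1, h2⟩, h3⟩ ⟨σ', τ', ⟨h1', h2'⟩, h3'⟩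
        refine ⟨σ.trans σ', τ.trans τ', ⟨fun z => ?_, fun i => ?_⟩, fun f => ?_⟩
        · rw [RingEquiv.trans_apply, h1, h1']
          rfl
        · rw [RingEquiv.trans_apply, h2, h2']
        · rw [RingEquiv.trans_apply, h3', h3] }

/-- The set of orbits of the group of automorphisms of `k` over `M` (the absolute Galois group of
`M` when `k` is an algebraic closure of `M`) on the points at infinity of `Y`. -/
def OrbitsAtInfinity (Y : IrredPlaneSet k) (M : Subfield k) : Type _ :=
  Quotient (Y.infinitySetoid M)

end IrredPlaneSet

end PreimageCurves

/-! ### Preimage chains in a valued field -/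

namespace PreimageCurves

open Polynomial

/-! Let `F` be the equation of a component with `deg_x F ≥ 2` (otherwise the bound is trivial), `ω`
a root of `F` in an algebraic closure of `k(t)`, and `v` a valuation there, trivial on `k`, with `v
t > 1`. The iterates of `ω`, read backwards, form a chain `z 0 = b, …, z M = ω` in which each term
is a preimage of the one before. An automorphism `g` over `k(t)` pulls `v` back to a point at
infinity of `Y`. All `v (g (z j))` are at most `v t`, and the itinerary of `g` records the `j` where
equality holds; it can be read off the point, since equality means that the function `t / z j` is
regular there. These functions involve no constant other than `c`, so if the group fixes `c`,
distinct itineraries give distinct orbits (`IrredPlaneSet.exists_orbits`).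

It remains to bound the degree of `z i` over `k(t)` by `2 ^ (number of itineraries up to i)`
(`IsPreimageChain.natDegree_minpoly_le`). Each step solves `w ^ 2 + (t - c z) w - z = 0`, so the
degree at most doubles. If it grows and some conjugate of `z = z i` has `v (c z - t) = v t`, the two
roots have a sum of size `v t` and a product of size at most `v t`; exactly one root has size `v t`,
and an itinerary splits. If no conjugate does, all conjugates of `z i` have size `v t`. Their
product divides `b` up to sign, so it has size at most `v t`, which forces `z i` to have degree one.

This needs every divisor of `b` to have size at most `v t`, which fails for `a = 0`; there the
component is moved to `b = -t` when necessary (`exists_base_point`). Finally, `c` is fixed by the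
automorphisms that fix `F`, because `F` passes through `(-1/c, 1/c)` when `c ≠ 0`
(`eval_neg_inv_eq_zero`, `apply_eq_self_of_map_eq`). -/

/-- The first `M + 1` terms of `z` form a chain of successive preimages of `b` under
`x ↦ (x ^ 2 + t x) / (c x + 1)`. -/
structure IsPreimageChain {Ω : Type*} [Field Ω] (b c t : Ω) (M : ℕ) (z : ℕ → Ω) : Prop where
  zero : z 0 = b
  step : ∀ i < M, z (i + 1) ^ 2 + t * z (i + 1) = z i * (c * z (i + 1) + 1)
  denom_ne_zero : ∀ i < M, c * z (i + 1) + 1 ≠ 0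

namespace IsPreimageChain

section Valuation

variable {Ω Γ : Type*} [Field Ω] [LinearOrderedCommGroupWithZero Γ] {v : Valuation Ω Γ}
  {b c t : Ω} {M : ℕ} {z : ℕ → Ω}

theorem ne_zero (h : IsPreimageChain b c t M z) (hb : b ≠ 0) : ∀ i ≤ M, z i ≠ 0 := by
  intro i
  induction i with
  | zero => intro _; rw [h.zero]; exact hb
  | succ i ih =>
    intro hi h0
    have := h.step i hi
    rw [h0] at this
    exact ih (by omega) (by simpa using this.symm)

theorem map {Ω' : Type*} [Field Ω'] (h : IsPreimageChain b c t M z) (f : Ω →+* Ω') :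
    IsPreimageChain (f b) (f c) (f t) M (fun i => f (z i)) where
  zero := by rw [h.zero]
  step i hi := by simpa using congrArg f (h.step i hi)
  denom_ne_zero i hi := by
    simpa using (map_ne_zero_iff f f.injective).2 (h.denom_ne_zero i hi)

/-- In `w ^ 2 = z (c w + 1) - t w` the right side has size at most `v t * v w` as soon as `v w > v
t`, which is too small. -/
theorem valuation_le (h : IsPreimageChain b c t M z) (ht : 1 < v t) (hc : v c ≤ 1)
    (hb : v b ≤ v t) : ∀ i ≤ M, v (z i) ≤ v t := by
  intro i
  induction i with
  | zero => intro _; rwa [h.zero]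
  | succ i ih =>
    intro hi
    have hz := ih (by omega)
    have hs := h.step i hi
    generalize z (i + 1) = w at hs ⊢
    by_contra! hw
    have hw0 : 0 < v w := lt_of_le_of_lt zero_le hw
    have h1 : v (c * w + 1) ≤ v w := by
      refine (v.map_add _ _).trans (max_le ?_ ?_)
      · rw [map_mul]; exact mul_le_of_le_one_left' hc
      · rw [map_one]; exact (ht.trans hw).le
    have h2 : v (w ^ 2) ≤ v t * v w := by
      rw [show w ^ 2 = z i * (c * w + 1) - t * w by linear_combination hs]
      refine (v.map_sub _ _).trans (max_le ?_ ?_)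
      · rw [map_mul]; exact mul_le_mul' hz h1
      · rw [map_mul]
    rw [map_pow, pow_two] at h2
    exact absurd h2 (not_le.2 (mul_lt_mul_of_pos_right hw hw0))

end Valuation

end IsPreimageChain

section Valuation

variable {Ω Γ : Type*} [Field Ω] [LinearOrderedCommGroupWithZero Γ] {v : Valuation Ω Γ}

/-- If the sum of two elements has the valuation of `t` and their product is small, then exactly
one of the two has the valuation of `t`. -/
theorem le_valuation_iff_not {t w w' y s : Ω} (ht : 1 < v t) (hy : v y ≤ v t) (hs : v s = v t) (hadd : w + w' = s) (hmul : w * w' = -y) :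
    v t ≤ v w ↔ ¬ v t ≤ v w' := by
  constructor
  · intro h1 h2
    have h3 : v t * v t ≤ v t := by
      calc v t * v t ≤ v w * v w' := mul_le_mul' h1 h2
        _ = v y := by rw [← map_mul, hmul, Valuation.map_neg]
        _ ≤ v t := hy
    have h4 : v t < v t * v t := by
      conv_lhs => rw [← one_mul (v t)]
      exact mul_lt_mul_of_pos_right ht (zero_lt_one.trans ht)
    exact absurd h3 (not_le.2 h4)
  · intro h2
    by_contra! h1
    have := v.map_add_lt h1 (not_le.1 h2)
    rw [hadd, hs] at this
    exact lt_irrefl _ this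

end Valuation

/-! ### Degrees and conjugates in simple extensions -/

section Adjoin

open IntermediateField

variable {K₀ Ω : Type*} [Field K₀] [Field Ω] [Algebra K₀ Ω] [Algebra.IsAlgebraic K₀ Ω]

theorem natDegree_minpoly_eq_finrank (x : Ω) :
    (minpoly K₀ x).natDegree = Module.finrank K₀ K₀⟮x⟯ :=
  (adjoin.finrank (Algebra.IsIntegral.isIntegral x)).symm

theorem isIntegral_and_natDegree_minpoly_le_two {A B : Type*} [Field A] [Field B] [Algebra A B]
    {x : B} (p q : A) (h : x ^ 2 + algebraMap A B p * x + algebraMap A B q = 0) :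
    IsIntegral A x ∧ (minpoly A x).natDegree ≤ 2 := by
  have hmon : (X ^ 2 + C p * X + C q).Monic := by monicity!
  have hroot : aeval x (X ^ 2 + C p * X + C q) = 0 := by simpa using h
  refine ⟨⟨_, hmon, hroot⟩, (natDegree_le_of_dvd (minpoly.dvd _ _ hroot) hmon.ne_zero).trans ?_⟩
  compute_degree!

/-- An element that satisfies a monic quadratic equation over `K₀(y)` has at most twice the degree
of `y`. -/
theorem natDegree_minpoly_le_two_mul {x y p q : Ω} (hp : p ∈ K₀⟮y⟯) (hq : q ∈ K₀⟮y⟯)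
    (h : x ^ 2 + p * x + q = 0) :
    (minpoly K₀ x).natDegree ≤ 2 * (minpoly K₀ y).natDegree := by
  have : FiniteDimensional K₀ K₀⟮y⟯ :=
    adjoin.finiteDimensional (Algebra.IsIntegral.isIntegral y)
  obtain ⟨hint, hdeg⟩ := isIntegral_and_natDegree_minpoly_le_two
    (A := K₀⟮y⟯) (x := x) ⟨p, hp⟩ ⟨q, hq⟩ h
  have : FiniteDimensional K₀⟮y⟯ K₀⟮y⟯⟮x⟯ := adjoin.finiteDimensional hint
  have : FiniteDimensional K₀ K₀⟮y⟯⟮x⟯ := FiniteDimensional.trans K₀ K₀⟮y⟯ K₀⟮y⟯⟮x⟯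
  rw [← adjoin.finrank hint] at hdeg
  have hle : K₀⟮x⟯ ≤ K₀⟮y⟯⟮x⟯.restrictScalars K₀ := by
    rw [adjoin_simple_le_iff]
    exact mem_adjoin_simple_self K₀⟮y⟯ x
  rw [natDegree_minpoly_eq_finrank, natDegree_minpoly_eq_finrank]
  have : FiniteDimensional K₀ (K₀⟮y⟯⟮x⟯.restrictScalars K₀) := ‹FiniteDimensional K₀ K₀⟮y⟯⟮x⟯›
  calc Module.finrank K₀ K₀⟮x⟯
      ≤ Module.finrank K₀ (K₀⟮y⟯⟮x⟯.restrictScalars K₀) :=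
        IntermediateField.finrank_le_of_le_right hle
    _ = Module.finrank K₀ K₀⟮y⟯ * Module.finrank K₀⟮y⟯ K₀⟮y⟯⟮x⟯ :=
        (Module.finrank_mul_finrank K₀ K₀⟮y⟯ K₀⟮y⟯⟮x⟯).symm
    _ ≤ Module.finrank K₀ K₀⟮y⟯ * 2 := Nat.mul_le_mul_left _ hdeg
    _ = _ := mul_comm _ _

theorem natDegree_minpoly_le_of_mem {x y : Ω} (h : x ∈ K₀⟮y⟯) :
    (minpoly K₀ x).natDegree ≤ (minpoly K₀ y).natDegree := by
  have : FiniteDimensional K₀ K₀⟮y⟯ :=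
    adjoin.finiteDimensional (Algebra.IsIntegral.isIntegral y)
  rw [natDegree_minpoly_eq_finrank, natDegree_minpoly_eq_finrank]
  exact IntermediateField.finrank_le_of_le_right (by rwa [adjoin_simple_le_iff])

/-- If all conjugates of `y` have valuation `γ`, so does the product of these conjugates, up to
the power given by the degree of `y`. -/
theorem valuation_coeff_zero_minpoly [IsAlgClosed Ω] {Γ : Type*}
    [LinearOrderedCommGroupWithZero Γ] (v : Valuation Ω Γ) {y : Ω} {γ : Γ}
    (h : ∀ g : Ω ≃ₐ[K₀] Ω, v (g y) = γ) :
    v (algebraMap K₀ Ω ((minpoly K₀ y).coeff 0)) = γ ^ (minpoly K₀ y).natDegree := by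
  have : Normal K₀ Ω := normal_iff.2 fun x =>
    ⟨Algebra.IsIntegral.isIntegral x, IsAlgClosed.splits _⟩
  have hmon := (minpoly.monic (Algebra.IsIntegral.isIntegral (R := K₀) y)).map (algebraMap K₀ Ω)
  have hs : ((minpoly K₀ y).map (algebraMap K₀ Ω)).Splits := IsAlgClosed.splits _
  rw [← coeff_map, hs.coeff_zero_eq_prod_roots_of_monic hmon, map_mul, map_pow,
    Valuation.map_neg, map_one, one_pow, one_mul, map_multiset_prod]
  rw [Multiset.map_congr rfl (g := fun _ => γ), Multiset.map_const', Multiset.prod_replicate,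
    ← hs.natDegree_eq_card_roots, natDegree_map]
  intro w hw
  have hroot : aeval w (minpoly K₀ y) = 0 := by
    rw [aeval_def, ← eval_map]
    exact (mem_roots hmon.ne_zero).1 hw
  obtain ⟨g, rfl⟩ := minpoly.exists_algEquiv_of_root' (Algebra.IsAlgebraic.isAlgebraic y) hroot
  exact h g

end Adjoin

/-! ### Integrality of the chain over the base ring -/

/-- The pair of polynomials in one variable over `R` that gives the `N`-th iterate of
`x ↦ (x ^ 2 + t x) / (c x + 1)`. -/
noncomputable def polyPair {R : Type*} [CommRing R] (c t : R) : ℕ → R[X] × R[X]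
  | 0 => (X, 1)
  | N + 1 =>
    ((polyPair c t N).1 ^ 2 + C t * (polyPair c t N).1 * (polyPair c t N).2,
      C c * (polyPair c t N).1 * (polyPair c t N).2 + (polyPair c t N).2 ^ 2)

/-- The point `0` is fixed by the map, with denominator `1` there. -/
theorem coeff_zero_polyPair {R : Type*} [CommRing R] (c t : R) (N : ℕ) :
    (polyPair c t N).1.coeff 0 = 0 ∧ (polyPair c t N).2.coeff 0 = 1 := by
  induction N with
  | zero => simp [polyPair]
  | succ N ih => simp [polyPair, pow_two, mul_coeff_zero, ih.1, ih.2]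

namespace IsPreimageChain

section Ring

variable {R Ω : Type*} [CommRing R] [Field Ω] [Algebra R Ω] {b c t : R} {M : ℕ} {z : ℕ → Ω}

/-- With the denominator cleared, `z (i + 1)` satisfies a monic quadratic equation over `R[z i]`. -/
theorem isIntegral
    (h : IsPreimageChain (algebraMap R Ω b) (algebraMap R Ω c) (algebraMap R Ω t) M z) :
    ∀ i ≤ M, IsIntegral R (z i) := by
  intro i
  induction i with
  | zero => intro _; rw [h.zero]; exact isIntegral_algebraMap
  | succ i ih =>
    intro hi
    have hz := ih (by omega)
    let A := integralClosure R Ω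
    have hp : algebraMap R Ω t - algebraMap R Ω c * z i ∈ A :=
      sub_mem (algebraMap_mem A t) (mul_mem (algebraMap_mem A c) hz)
    refine isIntegral_trans (R := R) (A := A) (z (i + 1)) ?_
    refine ⟨X ^ 2 + C ⟨_, hp⟩ * X - C ⟨z i, hz⟩, by monicity!, ?_⟩
    have := h.step i hi
    simp only [eval₂_sub, eval₂_add, eval₂_mul, eval₂_pow, eval₂_X, eval₂_C]
    change z (i + 1) ^ 2 + (algebraMap R Ω t - algebraMap R Ω c * z i) * z (i + 1) - z i = 0
    linear_combination this

theorem aeval_polyPair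
    (h : IsPreimageChain (algebraMap R Ω b) (algebraMap R Ω c) (algebraMap R Ω t) M z)
    {i : ℕ} (hi : i ≤ M) : ∀ j ≤ i,
    aeval (z i) (polyPair c t j).1 = z (i - j) * aeval (z i) (polyPair c t j).2 := by
  intro j
  induction j with
  | zero => simp [polyPair]
  | succ j ih =>
    intro hj
    obtain ⟨l, hl⟩ : ∃ l, i - j = l + 1 := ⟨i - j - 1, by omega⟩
    have ih := ih (by omega)
    have hs := h.step l (by omega)
    rw [show i - (j + 1) = l by omega]
    rw [hl] at ih
    simp only [polyPair, map_add, map_mul, map_pow, aeval_C, ih]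
    linear_combination (aeval (z i) (polyPair c t j).2) ^ 2 * hs

/-- The minimal polynomial over the integrally closed ring `R` divides `P_i - b Q_i`, whose constant
term is `-b`. This controls the norm of `z i`. -/
theorem coeff_zero_minpoly_dvd [IsDomain R] [IsIntegrallyClosed R] [FaithfulSMul R Ω]
    (h : IsPreimageChain (algebraMap R Ω b) (algebraMap R Ω c) (algebraMap R Ω t) M z)
    {i : ℕ} (hi : i ≤ M) : (minpoly R (z i)).coeff 0 ∣ b := by
  have hroot : aeval (z i) ((polyPair c t i).1 - C b * (polyPair c t i).2) = 0 := by
    rw [map_sub, map_mul, aeval_C, h.aeval_polyPair hi i le_rfl, Nat.sub_self, h.zero, sub_self]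
  obtain ⟨q, hq⟩ := minpoly.isIntegrallyClosed_dvd (h.isIntegral i hi) hroot
  have := congrArg (fun p => coeff p 0) hq
  simp only [coeff_sub, mul_coeff_zero, coeff_C_zero, (coeff_zero_polyPair c t i).1,
    (coeff_zero_polyPair c t i).2] at this
  exact ⟨-q.coeff 0, by linear_combination -this⟩

end Ring

end IsPreimageChain

/-! ### Counting itineraries -/

/-- The itinerary of length `i` of the conjugate `g` of the chain `z`: the levels at which the
conjugate has a pole as large as that of `t`. -/
def itinerary {Ω Γ G : Type*} [Field Ω] [LinearOrderedCommGroupWithZero Γ] [FunLike G Ω Ω]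
    (v : Valuation Ω Γ) (t : Ω) (z : ℕ → Ω) (i : ℕ) (g : G) : Set ℕ :=
  {j | j ≤ i ∧ v t ≤ v (g (z j))}

section Itinerary

variable {Ω Γ G : Type*} [Field Ω] [LinearOrderedCommGroupWithZero Γ] [FunLike G Ω Ω]
  (v : Valuation Ω Γ) (t : Ω) (z : ℕ → Ω)

theorem finite_range_itinerary (i : ℕ) : (Set.range (itinerary (G := G) v t z i)).Finite :=
  (Set.finite_Iic i).finite_subsets.subset (by rintro _ ⟨g, rfl⟩ j hj; exact hj.1)

theorem itinerary_eq_inter {i j : ℕ} (h : i ≤ j) (g : G) :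
    itinerary v t z i g = itinerary v t z j g ∩ Set.Iic i := by
  ext l
  simp only [itinerary, Set.mem_ofPred_eq, Set.mem_inter_iff, Set.mem_Iic]
  constructor
  · rintro ⟨h1, h2⟩; exact ⟨⟨h1.trans h, h2⟩, h1⟩
  · rintro ⟨⟨_, h2⟩, h1⟩; exact ⟨h1, h2⟩

theorem range_itinerary_eq_image {i j : ℕ} (h : i ≤ j) :
    Set.range (itinerary (G := G) v t z i) =
      (fun s => s ∩ Set.Iic i) '' Set.range (itinerary (G := G) v t z j) := by
  rw [← Set.range_comp]
  congr 1
  funext g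
  exact itinerary_eq_inter v t z h g

theorem ncard_range_itinerary_mono {i j : ℕ} (h : i ≤ j) :
    (Set.range (itinerary (G := G) v t z i)).ncard ≤
      (Set.range (itinerary (G := G) v t z j)).ncard := by
  rw [range_itinerary_eq_image v t z h]
  exact Set.ncard_image_le (finite_range_itinerary v t z j)

/-- Truncation maps the longer itineraries onto the shorter ones, and it identifies those of `g` and
`g'`, which differ at `i + 1`. -/
theorem ncard_range_itinerary_lt {i : ℕ} {g g' : G}
    (h : itinerary v t z i g = itinerary v t z i g')
    (h' : v t ≤ v (g (z (i + 1))) ↔ ¬ v t ≤ v (g' (z (i + 1)))) :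
    (Set.range (itinerary (G := G) v t z i)).ncard <
      (Set.range (itinerary (G := G) v t z (i + 1))).ncard := by
  have hfin := finite_range_itinerary (G := G) v t z (i + 1)
  refine lt_of_le_of_ne (ncard_range_itinerary_mono v t z (Nat.le_succ i)) fun heq => ?_
  rw [range_itinerary_eq_image v t z (Nat.le_succ i), Set.ncard_image_iff hfin] at heq
  have := heq ⟨g, rfl⟩ ⟨g', rfl⟩ (by
    simp only
    rw [← itinerary_eq_inter v t z (Nat.le_succ i), ← itinerary_eq_inter v t z (Nat.le_succ i), h])
  have := congrArg (fun s => i + 1 ∈ s) this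
  simp only [itinerary, Set.mem_ofPred_eq, le_refl, true_and, eq_iff_iff] at this
  tauto

theorem ncard_range_itinerary_pos [Nonempty G] (i : ℕ) :
    0 < (Set.range (itinerary (G := G) v t z i)).ncard :=
  (Set.ncard_pos (finite_range_itinerary v t z i)).2 (Set.range_nonempty _)

end Itinerary

/-! ### The degree of a chain element against the number of itineraries -/

section Degree

open IntermediateField

theorem IsPreimageChain.mem_adjoin {R K₀ Ω : Type*} [CommRing R] [Field K₀] [Algebra R K₀]
    [Field Ω] [Algebra K₀ Ω] [Algebra R Ω] [IsScalarTower R K₀ Ω] {b c t : R} {M : ℕ} {z : ℕ → Ω}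
    (h : IsPreimageChain (algebraMap R Ω b) (algebraMap R Ω c) (algebraMap R Ω t) M z)
    {i : ℕ} (hi : i ≤ M) : ∀ j ≤ i, z (i - j) ∈ K₀⟮z i⟯ := by
  intro j
  induction j with
  | zero => intro _; exact mem_adjoin_simple_self K₀ (z i)
  | succ j ih =>
    intro hj
    obtain ⟨l, hl⟩ : ∃ l, i - j = l + 1 := ⟨i - j - 1, by omega⟩
    have ih := ih (by omega)
    have hs := h.step l (by omega)
    rw [hl] at ih
    rw [show i - (j + 1) = l by omega,
      eq_div_of_mul_eq (h.denom_ne_zero l (by omega)) hs.symm]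
    have hR : ∀ r : R, algebraMap R Ω r ∈ K₀⟮z i⟯ := fun r => by
      rw [IsScalarTower.algebraMap_apply R K₀ Ω]
      exact IntermediateField.algebraMap_mem _ _
    exact div_mem (add_mem (pow_mem ih 2) (mul_mem (hR t) ih))
      (add_mem (mul_mem (hR c) ih) (one_mem _))

variable {R K₀ Ω Γ : Type*} [CommRing R] [IsDomain R] [IsIntegrallyClosed R] [Field K₀]
  [CharZero K₀] [Algebra R K₀] [IsFractionRing R K₀] [Field Ω] [Algebra K₀ Ω] [Algebra R Ω]
  [IsScalarTower R K₀ Ω] [Algebra.IsAlgebraic K₀ Ω] [IsAlgClosed Ω]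
  [LinearOrderedCommGroupWithZero Γ] {v : Valuation Ω Γ} {b c t : R} {M : ℕ} {z : ℕ → Ω}

/-- Induction along the chain: a doubling of the degree is paid for by a new itinerary, or starts
from degree one. The hypothesis on all divisors of `b` serves to bound the norm of `z i`. -/
theorem IsPreimageChain.natDegree_minpoly_le
    (h : IsPreimageChain (algebraMap R Ω b) (algebraMap R Ω c) (algebraMap R Ω t) M z)
    (ht : 1 < v (algebraMap R Ω t)) (hc : v (algebraMap R Ω c) ≤ 1)
    (hb : ∀ r, r ∣ b → v (algebraMap R Ω r) ≤ v (algebraMap R Ω t)) :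
    ∀ i ≤ M, (minpoly K₀ (z i)).natDegree ≤ 2 ^ (Set.range
      (itinerary (G := Ω ≃ₐ[K₀] Ω) v (algebraMap R Ω t) z i)).ncard := by
  have hfix : ∀ (g : Ω ≃ₐ[K₀] Ω) (r : R), g (algebraMap R Ω r) = algebraMap R Ω r := by
    intro g r
    rw [IsScalarTower.algebraMap_apply R K₀ Ω, g.commutes]
  have hconj : ∀ g : Ω ≃ₐ[K₀] Ω, IsPreimageChain (algebraMap R Ω b) (algebraMap R Ω c)
      (algebraMap R Ω t) M (fun i => g (z i)) := by
    intro g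
    have := h.map (g : Ω →+* Ω)
    simpa [hfix] using this
  have hval : ∀ (g : Ω ≃ₐ[K₀] Ω), ∀ i ≤ M, v (g (z i)) ≤ v (algebraMap R Ω t) := fun g =>
    (hconj g).valuation_le ht hc (hb b dvd_rfl)
  have hinj : FaithfulSMul R Ω := by
    rw [faithfulSMul_iff_algebraMap_injective, IsScalarTower.algebraMap_eq R K₀ Ω]
    exact (algebraMap K₀ Ω).injective.comp (IsFractionRing.injective R K₀)
  have : Normal K₀ Ω := normal_iff.2 fun x =>
    ⟨Algebra.IsIntegral.isIntegral x, IsAlgClosed.splits _⟩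
  have : IsGalois K₀ Ω := {}
  intro i
  induction i with
  | zero =>
    intro _
    rw [h.zero, IsScalarTower.algebraMap_apply R K₀ Ω, minpoly.eq_X_sub_C, natDegree_X_sub_C]
    exact Nat.one_le_two_pow
  | succ i ih =>
    intro hi
    have ih := ih (by omega)
    have hs := h.step i hi
    by_cases hmem : z (i + 1) ∈ K₀⟮z i⟯
    · exact (natDegree_minpoly_le_of_mem hmem).trans (ih.trans
        (Nat.pow_le_pow_right two_pos (ncard_range_itinerary_mono v _ z (Nat.le_succ i))))
    have hR : ∀ r : R, algebraMap R Ω r ∈ K₀⟮z i⟯ := fun r => by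
      rw [IsScalarTower.algebraMap_apply R K₀ Ω]
      exact IntermediateField.algebraMap_mem _ _
    have hzi : z i ∈ K₀⟮z i⟯ := mem_adjoin_simple_self K₀ (z i)
    have hdeg : (minpoly K₀ (z (i + 1))).natDegree ≤ 2 * (minpoly K₀ (z i)).natDegree :=
      natDegree_minpoly_le_two_mul
        (p := algebraMap R Ω t - algebraMap R Ω c * z i) (q := -z i)
        (sub_mem (hR t) (mul_mem (hR c) hzi)) (neg_mem hzi) (by linear_combination hs)
    by_cases hgood : ∃ g : Ω ≃ₐ[K₀] Ω,
        v (algebraMap R Ω c * g (z i) - algebraMap R Ω t) = v (algebraMap R Ω t)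
    · obtain ⟨g, hg⟩ := hgood
      -- By Galois theory some `f` fixes `K₀(z i)` and moves `z (i + 1)` to the other root. Earlier
      -- terms lie in `K₀(z i)`, so `g` and `g * f` have the same itinerary up to `i`.
      obtain ⟨f, hf, hfz⟩ : ∃ f : Ω ≃ₐ[K₀] Ω, f ∈ K₀⟮z i⟯.fixingSubgroup ∧
          f (z (i + 1)) ≠ z (i + 1) := by
        by_contra! hall
        apply hmem
        rw [← InfiniteGalois.fixedField_fixingSubgroup K₀⟮z i⟯, mem_fixedField_iff]
        exact hall
      rw [IntermediateField.mem_fixingSubgroup_iff] at hf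
      have hfi : f (z i) = z i := hf _ hzi
      have hlt := ncard_range_itinerary_lt v (algebraMap R Ω t) z (i := i) (g := g) (g' := g * f)
        (by
          ext j
          simp only [itinerary, Set.mem_ofPred_eq, AlgEquiv.mul_apply]
          refine and_congr_right fun hj => ?_
          rw [hf (z j)]
          have := h.mem_adjoin (K₀ := K₀) (i := i) (by omega) (i - j) (by omega)
          rwa [Nat.sub_sub_self hj] at this)
        (by
          have h1 := (hconj g).step i hi
          have h2 := (hconj (g * f)).step i hi
          simp only [AlgEquiv.mul_apply, hfi] at h1 h2
          have hne : g (z (i + 1)) - g (f (z (i + 1))) ≠ 0 :=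
            sub_ne_zero.2 fun he => hfz (g.injective he).symm
          -- The sum of the two roots comes from subtracting their equations and cancelling their
          -- nonzero difference.
          have hadd : g (z (i + 1)) + g (f (z (i + 1))) =
              algebraMap R Ω c * g (z i) - algebraMap R Ω t :=
            mul_left_cancel₀ hne (by linear_combination h1 - h2)
          refine le_valuation_iff_not ht (hval g i (by omega)) hg hadd ?_
          rw [AlgEquiv.mul_apply]
          linear_combination (g (z (i + 1))) * hadd - h1)
      calc _ ≤ _ := hdeg
        _ ≤ 2 * _ := Nat.mul_le_mul_left 2 ih
        _ = 2 ^ (_ + 1) := by rw [pow_succ, mul_comm]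
        _ ≤ _ := Nat.pow_le_pow_right two_pos hlt
    · push Not at hgood
      -- A conjugate smaller than `t` would make `t` dominate in `c * g (z i) - t`, so all
      -- conjugates have the size of `t`.
      have hbad : ∀ g : Ω ≃ₐ[K₀] Ω, v (g (z i)) = v (algebraMap R Ω t) := by
        intro g
        refine le_antisymm (hval g i (by omega)) ?_
        by_contra! hlt
        refine hgood g (v.map_sub_eq_of_lt_right ?_)
        rw [map_mul]
        exact lt_of_le_of_lt (mul_le_of_le_one_left' hc) hlt
      have hcoeff := valuation_coeff_zero_minpoly v hbad
      rw [minpoly.isIntegrallyClosed_eq_field_fractions' K₀ (h.isIntegral i (by omega)),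
        coeff_map, ← IsScalarTower.algebraMap_apply R K₀ Ω,
        ← minpoly.isIntegrallyClosed_eq_field_fractions' K₀ (h.isIntegral i (by omega))] at hcoeff
      have hle := hb _ (h.coeff_zero_minpoly_dvd (i := i) (by omega))
      rw [hcoeff] at hle
      -- The norm has size `v t ^ deg`, but it divides `b` and so has size at most `v t`.
      have hone : (minpoly K₀ (z i)).natDegree ≤ 1 := by
        by_contra! hd
        have : v (algebraMap R Ω t) ^ 1 < v (algebraMap R Ω t) ^ (minpoly K₀ (z i)).natDegree :=
          pow_lt_pow_right₀ ht hd
        rw [pow_one] at this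
        exact absurd hle (not_le.2 this)
      calc _ ≤ _ := hdeg
        _ ≤ 2 ^ 1 := by omega
        _ ≤ _ := Nat.pow_le_pow_right two_pos (ncard_range_itinerary_pos v _ z _)

end Degree

end PreimageCurves

/-! ### Degrees and special values of the iterates -/

namespace PreimageCurves

open MvPolynomial

section Iterates

variable {k : Type*} [Field k]

theorem map_iteratePair {k' : Type*} [Field k'] (f : k →+* k') (c : k) (N : ℕ) :
    map f (iteratePair c N).1 = (iteratePair (f c) N).1 ∧
      map f (iteratePair c N).2 = (iteratePair (f c) N).2 := by
  induction N with
  | zero => simp [iteratePair]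
  | succ N ih => simp [iteratePair, ih.1, ih.2]

theorem finSuccEquiv_iteratePair (c : k) (N : ℕ) :
    finSuccEquiv k 1 (iteratePair c N).1 = (polyPair (C c) (X 0) N).1 ∧
      finSuccEquiv k 1 (iteratePair c N).2 = (polyPair (C c) (X 0) N).2 := by
  have h1 : finSuccEquiv k 1 (X 1) = Polynomial.C (X 0) := finSuccEquiv_X_succ (j := 0)
  have hC : finSuccEquiv k 1 (C c) = Polynomial.C (C c) := by
    rw [finSuccEquiv_apply, eval₂Hom_C]; rfl
  induction N with
  | zero => simp [iteratePair, polyPair, finSuccEquiv_X_zero]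
  | succ N ih =>
    simp only [iteratePair, polyPair, map_add, map_mul, map_pow, ih.1, ih.2, h1, hC, and_self]

theorem monic_polyPair {R : Type*} [CommRing R] [Nontrivial R] (c t : R) (N : ℕ) :
    (polyPair c t N).1.Monic ∧ (polyPair c t N).1.natDegree = 2 ^ N ∧
      (polyPair c t N).2.natDegree < 2 ^ N := by
  induction N with
  | zero => simp [polyPair, Polynomial.monic_X]
  | succ N ih =>
    obtain ⟨h1, h2, h3⟩ := ih
    simp only [polyPair]
    generalize (polyPair c t N).1 = P at *
    generalize (polyPair c t N).2 = Q at *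
    have hP2 : (P ^ 2).natDegree = 2 ^ (N + 1) := by rw [h1.natDegree_pow, h2, pow_succ, mul_comm]
    have hPQ : ∀ s : R, (Polynomial.C s * P * Q).natDegree < 2 ^ (N + 1) := fun s => by
      have h4 := Polynomial.natDegree_mul_le (p := Polynomial.C s * P) (q := Q)
      have h5 := Polynomial.natDegree_C_mul_le s P
      rw [pow_succ]; omega
    have hlt : (Polynomial.C t * P * Q).degree < (P ^ 2).degree :=
      Polynomial.degree_lt_degree (by rw [hP2]; exact hPQ t)
    refine ⟨(h1.pow 2).add_of_left hlt, ?_, ?_⟩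
    · rw [Polynomial.natDegree_add_eq_left_of_degree_lt hlt, hP2]
    · refine lt_of_le_of_lt (Polynomial.natDegree_add_le _ _) (max_lt (hPQ c) ?_)
      have h4 := Polynomial.natDegree_pow_le (p := Q) (n := 2)
      have h5 := pow_succ 2 N
      omega

/-- Hence any factor has a nonzero constant as leading coefficient in `x`, and its roots are
integral over `k[t]`. -/
theorem monic_finSuccEquiv_sub (a c : k) (N : ℕ) :
    (finSuccEquiv k 1 ((iteratePair c N).1 - C a * (iteratePair c N).2)).Monic := by
  have hC : finSuccEquiv k 1 (C a) = Polynomial.C (C a) := by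
    rw [finSuccEquiv_apply, eval₂Hom_C]; rfl
  rw [map_sub, map_mul, (finSuccEquiv_iteratePair c N).1, (finSuccEquiv_iteratePair c N).2, hC]
  obtain ⟨h1, h2, h3⟩ := monic_polyPair (C c : MvPolynomial (Fin 1) k) (X 0) N
  refine h1.sub_of_left (Polynomial.degree_lt_degree ?_)
  rw [h2]
  exact lt_of_le_of_lt (Polynomial.natDegree_C_mul_le _ _) h3

/-- The denominator has smaller degree in `t`, which leaves room to multiply it by `b = -t`. -/
theorem degreeOf_one_iteratePair (c : k) (n : ℕ) :
    degreeOf 1 (iteratePair c (n + 1)).1 ≤ 2 ^ n ∧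
      degreeOf 1 (iteratePair c (n + 1)).2 + 1 ≤ 2 ^ n := by
  have hX : degreeOf 1 (X 1 : PlanePoly k) = 1 := by simp
  have hX0 : degreeOf 1 (X 0 : PlanePoly k) = 0 := by simp [degreeOf_X]
  have hC : degreeOf 1 (C c : PlanePoly k) = 0 := degreeOf_C _ _
  induction n with
  | zero =>
    have h1 := degreeOf_add_le 1 (X 0 ^ 2 : PlanePoly k) (X 1 * X 0)
    have h2 := degreeOf_mul_le 1 (X 1 : PlanePoly k) (X 0)
    have h3 := degreeOf_pow_le 1 (X 0 : PlanePoly k) 2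
    have h4 := degreeOf_add_le 1 (C c * X 0 : PlanePoly k) 1
    have h5 := degreeOf_mul_le 1 (C c : PlanePoly k) (X 0)
    have h6 : degreeOf 1 (1 : PlanePoly k) = 0 := degreeOf_one _
    simp only [iteratePair, mul_one, one_pow, pow_zero]
    omega
  | succ n ih =>
    rw [iteratePair]
    generalize (iteratePair c (n + 1)).1 = P at *
    generalize (iteratePair c (n + 1)).2 = Q at *
    have h1 := degreeOf_add_le 1 (P ^ 2) (X 1 * P * Q)
    have h2 := degreeOf_mul_le 1 (X 1 * P) Q
    have h2' := degreeOf_mul_le 1 (X 1) P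
    have h3 := degreeOf_pow_le 1 P 2
    have h4 := degreeOf_add_le 1 (C c * P * Q) (Q ^ 2)
    have h5 := degreeOf_mul_le 1 (C c * P) Q
    have h5' := degreeOf_mul_le 1 (C c) P
    have h6 := degreeOf_pow_le 1 Q 2
    have h7 := pow_succ 2 n
    dsimp only
    omega

theorem natDegree_aeval_C_X_le (u : k) (p : PlanePoly k) :
    (aeval ![Polynomial.C u, Polynomial.X] p : Polynomial k).natDegree ≤ degreeOf 1 p := by
  rw [aeval_def, eval₂_eq']
  refine Polynomial.natDegree_sum_le_of_forall_le _ _ fun m hm => ?_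
  have hle : m 1 ≤ degreeOf 1 p := monomial_le_degreeOf 1 hm
  simp only [Fin.prod_univ_two, Matrix.cons_val_zero, Matrix.cons_val_one]
  rw [← mul_assoc, ← Polynomial.C_pow, Polynomial.algebraMap_eq, ← Polynomial.C_mul]
  exact (Polynomial.natDegree_C_mul_X_pow_le _ _).trans hle

/-- On the line `x = -1/c` the first denominator `c x + 1` vanishes; from then on the denominator
stays zero and the numerator is squared. -/
theorem aeval_neg_inv_iteratePair {c : k} (hc : c ≠ 0) (n : ℕ) :
    (aeval ![Polynomial.C (-c⁻¹), Polynomial.X] (iteratePair c (n + 1)).1 : Polynomial k) =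
        (Polynomial.C (-c⁻¹) * (Polynomial.X - Polynomial.C c⁻¹)) ^ 2 ^ n ∧
      (aeval ![Polynomial.C (-c⁻¹), Polynomial.X] (iteratePair c (n + 1)).2 : Polynomial k) =
        0 := by
  induction n with
  | zero =>
    have h : (Polynomial.C c * Polynomial.C c⁻¹ : Polynomial k) = 1 := by
      rw [← Polynomial.C_mul, mul_inv_cancel₀ hc, Polynomial.C_1]
    simp only [iteratePair, map_add, map_mul, map_pow, map_one, aeval_X, aeval_C,
      Matrix.cons_val_zero, Matrix.cons_val_one, Polynomial.algebraMap_eq, Polynomial.C_neg]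
    constructor
    · ring
    · linear_combination -h
  | succ n ih =>
    rw [iteratePair]
    simp only [map_add, map_mul, map_pow, ih.1, ih.2]
    constructor
    · ring
    · ring

/-- At this point `x + t = 0` and `c' x + 1 = 1 - c'/c` is nonzero, so the map with parameter `c'`
sends `x` to the fixed point `0`. -/
theorem eval_neg_inv_iteratePair {c c' : k} (hc : c ≠ 0) (hcc : c' ≠ c) (n : ℕ) :
    eval ![-c⁻¹, c⁻¹] (iteratePair c' (n + 1)).1 = 0 ∧
      eval ![-c⁻¹, c⁻¹] (iteratePair c' (n + 1)).2 ≠ 0 := by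
  induction n with
  | zero =>
    simp only [iteratePair, map_add, map_mul, map_pow, map_one, eval_X, eval_C,
      Matrix.cons_val_zero, Matrix.cons_val_one]
    constructor
    · ring
    · intro h
      apply hcc
      field_simp at h
      linear_combination -h
  | succ n ih =>
    rw [iteratePair]
    simp only [map_add, map_mul, map_pow, ih.1]
    constructor
    · ring
    · simpa using ih.2

end Iterates

/-! ### Factors of the preimage equation determine `c` -/

section Factor

variable {k : Type*} [Field k]

theorem degreeOf_zero_le_one_of_degreeOf_one_eq_zero [IsAlgClosed k] {F : PlanePoly k}
    (hF : Irreducible F) (h : degreeOf 1 F = 0) : degreeOf 0 F ≤ 1 := by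
  let p : Polynomial k := aeval ![Polynomial.X, 0] F
  have hp : Polynomial.aeval (X 0 : PlanePoly k) p = F := by
    refine hom_congr_vars (f₁ := ((Polynomial.aeval (X 0 : PlanePoly k)).comp
      (aeval ![Polynomial.X, 0])).toRingHom) (f₂ := RingHom.id _) ?_ ?_ rfl
    · ext x; simp
    · intro i hi _
      fin_cases i
      · simp
      · exfalso
        exact mem_vars_iff_degreeOf_ne_zero.1 hi h
  by_cases hd : p.degree = 0
  · rw [Polynomial.eq_C_of_degree_eq_zero hd] at hp
    rw [← hp, Polynomial.aeval_C, algebraMap_eq, degreeOf_C]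
    exact zero_le
  obtain ⟨r, hr⟩ := IsAlgClosed.exists_root p hd
  obtain ⟨q, hq⟩ := Polynomial.dvd_iff_isRoot.2 hr
  rw [hq, map_mul, map_sub, Polynomial.aeval_X, Polynomial.aeval_C, algebraMap_eq] at hp
  rw [← hp] at hF
  rcases of_irreducible_mul hF with hu | hu
  · have := hu.map (eval ![r, 0])
    simp at this
  · obtain ⟨s, _, hs⟩ := isUnit_iff_eq_C_of_isReduced.1 hu
    have h1 := degreeOf_mul_le 0 (X 0 - C r : PlanePoly k) (C s)
    have h2 := degreeOf_sub_le 0 (X 0 : PlanePoly k) (C r)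
    have h3 : degreeOf 0 (X 0 : PlanePoly k) = 1 := by simp
    rw [degreeOf_C] at h1 h2
    rw [← hp, hs]
    omega

theorem degreeOf_le_of_dvd {F G : PlanePoly k} (hG : G ≠ 0) (h : F ∣ G) (i : Fin 2) :
    degreeOf i F ≤ degreeOf i G := by
  obtain ⟨H, rfl⟩ := h
  rw [degreeOf_mul_eq (left_ne_zero_of_mul hG) (right_ne_zero_of_mul hG)]
  omega

/-- A factor of degree at least `2` in `x` of the equation of the preimage curve of a point `b` with
`deg_t b ≤ 1` passes through the point `(-1/c, 1/c)`. -/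
theorem eval_neg_inv_eq_zero [IsAlgClosed k] {F b : PlanePoly k} (hF : Irreducible F)
    (hd : 2 ≤ degreeOf 0 F) {c : k} (hc : c ≠ 0) (hb : degreeOf 1 b ≤ 1) {n : ℕ}
    (hdvd : F ∣ (iteratePair c (n + 1)).1 - b * (iteratePair c (n + 1)).2) :
    eval ![-c⁻¹, c⁻¹] F = 0 := by
  by_contra hev
  obtain ⟨H, hH⟩ := hdvd
  -- Restriction to the line `x = -1/c`. The whole equation becomes a constant times `(t - 1/c) ^ 2
  -- ^ n`, and `2 ^ n` bounds its degree in `t`.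
  let ev : PlanePoly k →ₐ[k] Polynomial k := aeval ![Polynomial.C (-c⁻¹), Polynomial.X]
  have hG : ev ((iteratePair c (n + 1)).1 - b * (iteratePair c (n + 1)).2) =
      (Polynomial.C (-c⁻¹) * (Polynomial.X - Polynomial.C c⁻¹)) ^ 2 ^ n := by
    simp only [ev, map_sub, map_mul, aeval_neg_inv_iteratePair hc, mul_zero, sub_zero]
  have hG0 : (Polynomial.C (-c⁻¹) * (Polynomial.X - Polynomial.C c⁻¹)) ^ 2 ^ n ≠ 0 :=
    pow_ne_zero _ (mul_ne_zero (by simpa using hc) (Polynomial.X_sub_C_ne_zero _))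
  have hnd : ((Polynomial.C (-c⁻¹) * (Polynomial.X - Polynomial.C c⁻¹)) ^ 2 ^ n).natDegree =
      2 ^ n := by
    rw [Polynomial.natDegree_pow, Polynomial.natDegree_C_mul (by simpa using hc),
      Polynomial.natDegree_X_sub_C, mul_one]
  have hdeg : degreeOf 1 ((iteratePair c (n + 1)).1 - b * (iteratePair c (n + 1)).2) ≤ 2 ^ n := by
    have h1 := degreeOf_sub_le 1 (iteratePair c (n + 1)).1 (b * (iteratePair c (n + 1)).2)
    have h2 := degreeOf_mul_le 1 b (iteratePair c (n + 1)).2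
    have h3 := degreeOf_one_iteratePair c n
    omega
  have hFH : ev F * ev H =
      (Polynomial.C (-c⁻¹) * (Polynomial.X - Polynomial.C c⁻¹)) ^ 2 ^ n := by
    rw [← map_mul, ← hH, hG]
  -- The restriction of `F` divides a power of `t - 1/c` and does not vanish at `1/c`.
  have hunit : IsUnit (ev F) := by
    have hcop : IsCoprime (ev F) ((Polynomial.X - Polynomial.C c⁻¹) ^ 2 ^ n) := by
      refine IsCoprime.pow_right (IsCoprime.symm ?_)
      rw [(Polynomial.irreducible_X_sub_C c⁻¹).coprime_iff_not_dvd, Polynomial.dvd_iff_isRoot,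
        Polynomial.IsRoot.def]
      intro h0
      apply hev
      rw [← h0, ← Polynomial.coe_evalRingHom]
      refine hom_congr_vars (f₂ := (Polynomial.evalRingHom c⁻¹).comp ev.toRingHom) ?_ ?_ rfl
      · ext x; simp
      · intro i _ _
        fin_cases i <;> simp [ev]
    refine hcop.isUnit_of_dvd' dvd_rfl ?_
    have hu : IsUnit (Polynomial.C (-c⁻¹) ^ 2 ^ n) :=
      (Polynomial.isUnit_C.2 (by simpa using hc)).pow _
    rw [← hu.dvd_mul_left, ← mul_pow, ← hFH]
    exact dvd_mul_right _ _
  -- The cofactor `H` already accounts for the full degree `2 ^ n` in `t`; thus `F` is a polynomial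
  -- in `x` alone, hence linear over an algebraically closed field.
  have hzero : degreeOf 1 F = 0 := by
    have h1 := natDegree_aeval_C_X_le (-c⁻¹) F
    have h2 := natDegree_aeval_C_X_le (-c⁻¹) H
    have h3 := congrArg Polynomial.natDegree hFH
    have hne := hFH ▸ hG0
    rw [Polynomial.natDegree_mul (left_ne_zero_of_mul hne) (right_ne_zero_of_mul hne), hnd,
      Polynomial.natDegree_eq_zero_of_isUnit hunit] at h3
    have hne' : F * H ≠ 0 := fun h0 => hne (by rw [← map_mul, h0, map_zero])
    rw [hH, degreeOf_mul_eq (left_ne_zero_of_mul hne') (right_ne_zero_of_mul hne')] at hdeg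
    change (ev H).natDegree ≤ _ at h2
    omega
  have := degreeOf_zero_le_one_of_degreeOf_one_eq_zero hF hzero
  omega

/-- A component of degree at least `2` in `x` of the preimage curve of `a` is a component of a
preimage curve of positive level of `a ≠ 0` or of `-t`. -/
theorem exists_base_point {F : PlanePoly k} (hF : Irreducible F) (hd : 2 ≤ degreeOf 0 F)
    {a c : k} {N : ℕ} (hdvd : F ∣ (iteratePair c N).1 - C a * (iteratePair c N).2) :
    ∃ (n : ℕ) (b : PlanePoly k), ((a ≠ 0 ∧ b = C a) ∨ b = -X 1) ∧
      F ∣ (iteratePair c (n + 1)).1 - b * (iteratePair c (n + 1)).2 := by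
  have hX : degreeOf 0 (X 0 : PlanePoly k) = 1 := by simp
  have hX1 : degreeOf 0 (X 1 : PlanePoly k) = 0 := by simp [degreeOf_X]
  have hlin : ∀ G : PlanePoly k, degreeOf 0 G ≤ 1 → G ≠ 0 → ¬ F ∣ G := fun G hG hG0 h => by
    have := degreeOf_le_of_dvd hG0 h 0
    omega
  by_cases ha : a = 0
  · subst ha
    rw [C_0, zero_mul, sub_zero] at hdvd
    have hprime : Prime F := UniqueFactorizationMonoid.irreducible_iff_prime.1 hF
    induction N with
    | zero => exact absurd hdvd (hlin _ hX.le (X_ne_zero 0))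
    | succ N ih =>
      -- A preimage of `0` is `0` or `-t`. The first case lowers the level; the second changes the
      -- base point.
      have h : F ∣ (iteratePair c N).1 * ((iteratePair c N).1 + X 1 * (iteratePair c N).2) := by
        convert hdvd using 1
        rw [iteratePair]; ring
      rcases hprime.dvd_or_dvd h with h | h
      · exact ih h
      cases N with
      | zero =>
        refine absurd h (hlin _ ?_ ?_)
        · have := degreeOf_add_le 0 (X 0 : PlanePoly k) (X 1)
          simp only [iteratePair, mul_one]
          omega
        · intro h0
          have := congrArg (eval ![1, 0]) h0
          simp [iteratePair] at this
      | succ n => exact ⟨n, -X 1, Or.inr rfl, by rwa [neg_mul, sub_neg_eq_add]⟩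
  · cases N with
    | zero =>
      refine absurd hdvd (hlin _ ?_ ?_)
      · have := degreeOf_sub_le 0 (X 0 : PlanePoly k) (C a)
        rw [degreeOf_C] at this
        simp only [iteratePair, mul_one]
        omega
      · intro h0
        have := congrArg (eval ![a + 1, 0]) h0
        simp [iteratePair] at this
    | succ n => exact ⟨n, C a, Or.inl ⟨ha, rfl⟩, hdvd⟩

/-- If `σ` moved `c`, then `F` would also divide the equation for `σ c`. At the point `(-1/c, 1/c)`
of `F = 0` this equation reduces to the image of `b` under `σ` times a nonzero factor, and that
image does not vanish there. -/
theorem apply_eq_self_of_map_eq [IsAlgClosed k] {F : PlanePoly k} (hF : Irreducible F)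
    (hd : 2 ≤ degreeOf 0 F) {a c : k} {b : PlanePoly k} (hb : (a ≠ 0 ∧ b = C a) ∨ b = -X 1) {n : ℕ}
    (hdvd : F ∣ (iteratePair c (n + 1)).1 - b * (iteratePair c (n + 1)).2)
    {σ : k →+* k} (hσ : map σ F = F) : σ c = c := by
  by_cases hc : c = 0
  · rw [hc, map_zero]
  by_contra hne
  have hdeg : degreeOf 1 b ≤ 1 := by
    rcases hb with ⟨_, rfl⟩ | rfl
    · rw [degreeOf_C]; exact zero_le
    · rw [degreeOf_neg]; simp
  have hev := eval_neg_inv_eq_zero hF hd hc hdeg hdvd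
  have hdvd' := map_dvd (map σ) hdvd
  rw [hσ, map_sub, map_mul, (map_iteratePair σ c _).1, (map_iteratePair σ c _).2] at hdvd'
  have h0 := map_dvd (eval ![-c⁻¹, c⁻¹]) hdvd'
  obtain ⟨h1, h2⟩ := eval_neg_inv_iteratePair hc hne n
  rw [hev, zero_dvd_iff, map_sub, map_mul, h1, zero_sub, neg_eq_zero] at h0
  rcases mul_eq_zero.1 h0 with h0 | h0
  · rcases hb with ⟨ha, rfl⟩ | rfl
    · simp [ha] at h0
    · simp [hc] at h0
  · exact h2 h0

end Factor

end PreimageCurves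

/-! ### Components and their equations -/

namespace PreimageCurves

open MvPolynomial

section Component

variable {k : Type*} [Field k] [IsAlgClosed k]

/-- Some irreducible factor `F` of `G` lies in the prime ideal of `Y`. By the Nullstellensatz `F =
0` is irreducible with ideal `(F)`, and it lies between `Y` and `G = 0`; maximality of `Y` gives
equality. -/
theorem IrredPlaneSet.IsComponentOf.exists_ideal_eq_span {Y : IrredPlaneSet k} {G : PlanePoly k}
    (hG : G ≠ 0) (hY : Y.IsComponentOf (zeroLocus k (Ideal.span {G}))) :
    ∃ F, Irreducible F ∧ F ∣ G ∧ Y.ideal = Ideal.span {F} := by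
  have hGY : G ∈ Y.ideal := fun x hx => hY.1 hx G (Ideal.mem_span_singleton_self G)
  obtain ⟨F, hF, hFY⟩ := (Y.isPrime.multiset_prod_mem_iff_exists_mem
    (UniqueFactorizationMonoid.factors G)).1
    (Y.ideal.mem_of_dvd (UniqueFactorizationMonoid.factors_prod hG).symm.dvd hGY)
  have hFG : F ∣ G := UniqueFactorizationMonoid.dvd_of_mem_factors hF
  have hirr : Irreducible F := UniqueFactorizationMonoid.irreducible_of_factor F hF
  have hp : (Ideal.span {F} : Ideal (PlanePoly k)).IsPrime :=
    (Ideal.span_singleton_prime hirr.ne_zero).2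
      (UniqueFactorizationMonoid.irreducible_iff_prime.1 hirr)
  have hv : vanishingIdeal k (zeroLocus k (Ideal.span {F})) = Ideal.span {F} :=
    IsPrime.vanishingIdeal_zeroLocus _
  let W : IrredPlaneSet k := ⟨zeroLocus k (Ideal.span {F}), by rw [hv], by rwa [hv]⟩
  have hle : (Ideal.span {F} : Ideal (PlanePoly k)) ≤ Y.ideal := by
    rwa [Ideal.span_singleton_le_iff_mem]
  have hYW : Y.carrier ⊆ W.carrier := by
    have := zeroLocus_anti_mono (K := k) hle
    rwa [IrredPlaneSet.ideal, Y.isAlgebraic] at this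
  have hWZ : W.carrier ⊆ zeroLocus k (Ideal.span {G}) :=
    zeroLocus_anti_mono ((Ideal.span_singleton_le_span_singleton).2 hFG)
  refine ⟨F, hirr, hFG, ?_⟩
  rw [IrredPlaneSet.ideal, hYW.antisymm (hY.2 W hWZ hYW), hv]

end Component

/-! ### The minimal field of definition -/

section FieldOfDefinition

variable {k : Type*} [Field k]

/-- A linear form on the field extension `k / M`, applied to the coefficients of a polynomial. -/
noncomputable def mapCoeffs {M : Subfield k} (φ : k →ₗ[M] M) (p : PlanePoly k) :
    MvPolynomial (Fin 2) M :=
  ∑ m ∈ p.support, monomial m (φ (coeff m p))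

theorem coeff_mapCoeffs {M : Subfield k} (φ : k →ₗ[M] M) (p : PlanePoly k) (m : Fin 2 →₀ ℕ) :
    coeff m (mapCoeffs φ p) = φ (coeff m p) := by
  classical
  simp only [mapCoeffs, coeff_sum, coeff_monomial, Finset.sum_ite_eq', mem_support_iff]
  split_ifs with h
  · rfl
  · rw [not_not.1 h, map_zero]

theorem mapCoeffs_add {M : Subfield k} (φ : k →ₗ[M] M) (p q : PlanePoly k) :
    mapCoeffs φ (p + q) = mapCoeffs φ p + mapCoeffs φ q := by
  ext m
  simp only [coeff_mapCoeffs, coeff_add, map_add]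

theorem mapCoeffs_mul_map {M : Subfield k} (φ : k →ₗ[M] M) (p : PlanePoly k)
    (f : MvPolynomial (Fin 2) M) :
    mapCoeffs φ (p * map M.subtype f) = mapCoeffs φ p * f := by
  classical
  ext m
  simp only [coeff_mapCoeffs, coeff_mul, map_sum, coeff_map]
  congr 1
  refine Finset.sum_congr rfl fun x _ => ?_
  rw [mul_comm, mul_comm (φ _), ← smul_eq_mul (coeff x.2 f), ← map_smul]
  rfl

theorem mapCoeffs_mem {M : Subfield k} (φ : k →ₗ[M] M) {J : Ideal (MvPolynomial (Fin 2) M)}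
    {p : PlanePoly k} (hp : p ∈ J.map (map M.subtype)) : mapCoeffs φ p ∈ J := by
  suffices ∀ h, mapCoeffs φ (h * p) ∈ J by simpa using this 1
  refine Submodule.span_induction (p := fun q _ => ∀ h, mapCoeffs φ (h * q) ∈ J) ?_ ?_ ?_ ?_ hp
  · rintro _ ⟨f, hf, rfl⟩ h
    rw [mapCoeffs_mul_map]
    exact J.mul_mem_left _ hf
  · intro h
    rw [mul_zero, show mapCoeffs φ 0 = 0 by simp [mapCoeffs]]
    exact J.zero_mem
  · intro x y _ _ hx hy h
    rw [mul_add, mapCoeffs_add]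
    exact J.add_mem (hx h) (hy h)
  · intro q x _ hx h
    rw [smul_eq_mul, ← mul_assoc]
    exact hx _

/-- If an ideal generated by polynomials over `M` is generated by a single polynomial with some
coefficient equal to `1`, then this polynomial has coefficients in `M`. -/
theorem coeff_mem_of_span_eq_map {M : Subfield k} {J : Ideal (MvPolynomial (Fin 2) M)}
    {F : PlanePoly k} (hF : Ideal.span {F} = J.map (map M.subtype)) {m : Fin 2 →₀ ℕ}
    (hm : coeff m F = 1) (n : Fin 2 →₀ ℕ) : coeff n F ∈ M := by
  -- An `M`-linear retraction `φ` of `k` onto `M`. Applied to coefficients it preserves the ideal,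
  -- so it sends `F` to a multiple of `F` of no larger degree; the coefficient `1` shows that the
  -- multiplier is `1`.
  obtain ⟨φ, hφ⟩ := LinearMap.exists_leftInverse_of_injective (Algebra.linearMap M k)
    (LinearMap.ker_eq_bot.2 M.subtype.injective)
  have hφ1 : φ 1 = 1 := by
    have := LinearMap.congr_fun hφ 1
    simpa using this
  have hFJ : F ∈ J.map (map M.subtype) := hF ▸ Ideal.mem_span_singleton_self F
  have hmem : map M.subtype (mapCoeffs φ F) ∈ Ideal.span {F} := by
    rw [hF]
    exact Ideal.mem_map_of_mem _ (mapCoeffs_mem φ hFJ)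
  obtain ⟨H, hH⟩ := Ideal.mem_span_singleton.1 hmem
  have hcoeff : ∀ l, coeff l (F * H) = φ (coeff l F) := fun l => by
    rw [← hH, coeff_map, coeff_mapCoeffs]; rfl
  have hFH : F * H ≠ 0 := fun h0 => by
    have := hcoeff m
    rw [h0, coeff_zero, hm, hφ1] at this
    exact zero_ne_one this
  have hdeg : (F * H).totalDegree ≤ F.totalDegree := by
    refine Finset.sup_mono fun l hl => ?_
    rw [mem_support_iff, hcoeff] at hl
    rw [mem_support_iff]
    intro h0
    rw [h0, map_zero] at hl
    exact hl rfl
  rw [totalDegree_mul_of_isDomain (left_ne_zero_of_mul hFH) (right_ne_zero_of_mul hFH)] at hdeg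
  have hH0 : H.totalDegree = 0 := by omega
  rw [totalDegree_eq_zero_iff_eq_C] at hH0
  have hone := hcoeff m
  rw [hH0, mul_comm, coeff_C_mul, hm, mul_one, hφ1] at hone
  have := hcoeff n
  rw [hH0, hone, mul_comm, coeff_C_mul] at this
  have h1 : ((1 : M) : k) = 1 := rfl
  rw [h1, one_mul] at this
  rw [this]
  exact SetLike.coe_mem _

/-- The subfield generated by the coefficients of a polynomial. -/
def coeffField (F : PlanePoly k) : Subfield k :=
  Subfield.closure (Set.range fun n => coeff n F)

theorem coeff_mem_coeffField (F : PlanePoly k) (n : Fin 2 →₀ ℕ) : coeff n F ∈ coeffField F :=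
  Subfield.subset_closure ⟨n, rfl⟩

theorem map_eq_self_of_coeffField {F : PlanePoly k} (σ : k ≃ₐ[coeffField F] k) :
    map (σ.toRingEquiv : k →+* k) F = F := by
  ext n
  rw [coeff_map]
  exact σ.commutes ⟨_, coeff_mem_coeffField F n⟩

theorem IrredPlaneSet.isLeast_coeffField {Y : IrredPlaneSet k} {F : PlanePoly k}
    (hY : Y.ideal = Ideal.span {F}) {m : Fin 2 →₀ ℕ} (hm : coeff m F = 1) :
    IsLeast {M : Subfield k | Y.IsDefinedOver M} (coeffField F) := by
  constructor
  · have hr : F ∈ Set.range (map (coeffField F).subtype) := by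
      rw [mem_range_map_iff_coeffs_subset]
      intro x hx
      obtain ⟨n, _, rfl⟩ := mem_coeffs_iff.1 hx
      exact ⟨⟨_, coeff_mem_coeffField F n⟩, rfl⟩
    obtain ⟨F₀, hF₀⟩ := hr
    refine ⟨Ideal.span {F₀}, ?_⟩
    rw [Ideal.map_span, Set.image_singleton, hF₀, hY]
  · rintro M ⟨J, hJ⟩
    refine Subfield.closure_le.2 ?_
    rintro _ ⟨n, rfl⟩
    exact coeff_mem_of_span_eq_map (hY ▸ hJ) hm n

end FieldOfDefinition

/-! ### A valuation ring with a pole at `t` -/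

section ValuationAtInfinity

/-- As `t` is transcendental, `t⁻¹` is not a unit of `k[t⁻¹]`, so some valuation ring contains
`k[t⁻¹]` and has `t⁻¹` in its maximal ideal. -/
theorem exists_valuationSubring_notMem {k Ω : Type*} [Field k] [Field Ω] [Algebra k Ω] {t : Ω}
    (ht : Transcendental k t) :
    ∃ V : ValuationSubring Ω, (∀ x : k, algebraMap k Ω x ∈ V) ∧ t ∉ V := by
  have ht0 : t ≠ 0 := fun h => ht (h ▸ isAlgebraic_zero)
  let A : Subring Ω := (Algebra.adjoin k {t⁻¹}).toSubring
  have htA : t⁻¹ ∈ A := Algebra.subset_adjoin rfl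
  have hI : (Ideal.span {(⟨t⁻¹, htA⟩ : A)}) ≠ ⊤ := by
    rw [Ne, Ideal.span_singleton_eq_top, isUnit_iff_exists_inv]
    rintro ⟨⟨a, ha⟩, hmul⟩
    have hmul' : t⁻¹ * a = 1 := congrArg Subtype.val hmul
    obtain ⟨p, rfl⟩ := (Algebra.adjoin_singleton_eq_range_aeval k t⁻¹ ▸ ha :
      a ∈ (Polynomial.aeval (R := k) t⁻¹).range)
    apply ht
    rw [← inv_inv t]
    refine IsAlgebraic.inv ⟨Polynomial.X * p - 1, fun h0 => ?_, ?_⟩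
    · have := congrArg (Polynomial.eval 0) h0
      simp at this
    · rw [map_sub, map_mul, Polynomial.aeval_X, map_one]
      exact sub_eq_zero.2 hmul'
  obtain ⟨V, hA, hV⟩ := Ideal.image_subset_nonunits_valuationSubring _ hI
  refine ⟨V, fun x => hA ((Algebra.adjoin k {t⁻¹}).algebraMap_mem x), fun h => ?_⟩
  have h1 : t⁻¹ ∈ V.nonunits := hV ⟨⟨t⁻¹, htA⟩, Ideal.mem_span_singleton_self _, rfl⟩
  rw [ValuationSubring.mem_nonunits_iff] at h1
  rw [← V.valuation_le_one_iff] at h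
  have h2 : V.valuation (t⁻¹ * t) < 1 := by
    rw [map_mul]
    exact mul_lt_one_of_lt_of_le h1 h
  rw [inv_mul_cancel₀ ht0, map_one] at h2
  exact lt_irrefl _ h2

end ValuationAtInfinity

/-! ### The chain attached to a root -/

section Chain

variable {k : Type*} [Field k]

theorem iteratePair_snd_dvd (c : k) {i j : ℕ} (h : i ≤ j) :
    (iteratePair c i).2 ∣ (iteratePair c j).2 := by
  induction j, h using Nat.le_induction with
  | base => exact dvd_rfl
  | succ j _ ih =>
    refine ih.trans ⟨C c * (iteratePair c j).1 + (iteratePair c j).2, ?_⟩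
    rw [iteratePair]; ring

/-- A zero of the equation of the preimage curve of `β` gives a chain of preimages of `β`. -/
theorem isPreimageChain_of_eq {Ω : Type*} [Field Ω] (e : PlanePoly k →+* Ω) {c : k} {M : ℕ} {β : Ω}
    (hQ : e (iteratePair c M).2 ≠ 0) (h : e (iteratePair c M).1 = β * e (iteratePair c M).2) :
    IsPreimageChain β (e (C c)) (e (X 1)) M
      (fun i => e (iteratePair c (M - i)).1 / e (iteratePair c (M - i)).2) := by
  have hQ' : ∀ j ≤ M, e (iteratePair c j).2 ≠ 0 := fun j hj h0 => by
    have := map_dvd e (iteratePair_snd_dvd c hj)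
    rw [h0, zero_dvd_iff] at this
    exact hQ this
  have hden : ∀ j < M, (e (C c) * (e (iteratePair c j).1 / e (iteratePair c j).2) + 1) *
      e (iteratePair c j).2 ^ 2 = e (iteratePair c (j + 1)).2 := fun j hj => by
    have := hQ' j hj.le
    simp only [iteratePair, map_add, map_mul, map_pow]
    field_simp
  have hnum : ∀ j < M, ((e (iteratePair c j).1 / e (iteratePair c j).2) ^ 2 +
      e (X 1) * (e (iteratePair c j).1 / e (iteratePair c j).2)) *
      e (iteratePair c j).2 ^ 2 = e (iteratePair c (j + 1)).1 := fun j hj => by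
    have := hQ' j hj.le
    simp only [iteratePair, map_add, map_mul, map_pow]
    field_simp
  refine ⟨?_, fun i hi => ?_, fun i hi h0 => ?_⟩
  · rw [Nat.sub_zero, h, mul_div_cancel_right₀ _ hQ]
  · obtain ⟨j, hj⟩ : ∃ j, M - i = j + 1 := ⟨M - i - 1, by omega⟩
    have h1 : M - (i + 1) = j := by omega
    simp only [hj, h1]
    refine mul_right_cancel₀ (pow_ne_zero 2 (hQ' j (by omega))) ?_
    rw [hnum j (by omega), mul_assoc, hden j (by omega),
      div_mul_cancel₀ _ (hQ' (j + 1) (by omega))]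
  · have := hden (M - (i + 1)) (by omega)
    rw [h0, zero_mul] at this
    exact hQ' _ (by omega) this.symm

end Chain

end PreimageCurves

/-! ### Embedding the function field in an algebraic closure of `k(t)` -/

namespace PreimageCurves

open MvPolynomial

section Embedding

variable {k : Type*} [Field k]

/-- An algebraic closure of `k(t)`. -/
abbrev RatClosure (k : Type*) [Field k] : Type _ :=
  AlgebraicClosure (FractionRing (MvPolynomial (Fin 1) k))

/-- The evaluation of polynomials in `x` and `t` at `x = ω` in an algebraic closure of `k(t)`. -/
noncomputable def evalAt (ω : RatClosure k) : PlanePoly k →+* RatClosure k :=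
  (Polynomial.aeval (R := MvPolynomial (Fin 1) k) ω).toRingHom.comp
    (finSuccEquiv k 1 : PlanePoly k →+* _)

theorem evalAt_apply (ω : RatClosure k) (p : PlanePoly k) :
    evalAt ω p = Polynomial.aeval (R := MvPolynomial (Fin 1) k) ω (finSuccEquiv k 1 p) := rfl

theorem evalAt_X_zero (ω : RatClosure k) : evalAt ω (X 0) = ω := by
  rw [evalAt_apply, finSuccEquiv_X_zero, Polynomial.aeval_X]

theorem evalAt_X_one (ω : RatClosure k) :
    evalAt ω (X 1) = algebraMap (MvPolynomial (Fin 1) k) (RatClosure k) (X 0) := by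
  rw [evalAt_apply, show (X 1 : PlanePoly k) = X (Fin.succ 0) from rfl, finSuccEquiv_X_succ,
    Polynomial.aeval_C]

theorem evalAt_C (ω : RatClosure k) (a : k) :
    evalAt ω (C a) = algebraMap (MvPolynomial (Fin 1) k) (RatClosure k) (C a) := by
  rw [evalAt_apply, finSuccEquiv_apply, eval₂Hom_C, RingHom.comp_apply, Polynomial.aeval_C]

theorem algebraMap_ratClosure_injective :
    Function.Injective (algebraMap (MvPolynomial (Fin 1) k) (RatClosure k)) := by
  rw [IsScalarTower.algebraMap_eq _ (FractionRing (MvPolynomial (Fin 1) k)) (RatClosure k)]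
  exact (algebraMap (FractionRing (MvPolynomial (Fin 1) k)) (RatClosure k)).injective.comp (IsFractionRing.injective _ _)

instance : FaithfulSMul (MvPolynomial (Fin 1) k) (RatClosure k) :=
  (faithfulSMul_iff_algebraMap_injective _ _).2 algebraMap_ratClosure_injective

variable {F : PlanePoly k} {ω : RatClosure k}

/-- As `k[t]` is integrally closed, the minimal polynomial of `ω` over it divides `F`; it is not a
unit, so irreducibility makes the two associated. -/
theorem dvd_minpoly_of_evalAt_eq_zero (hF : Irreducible F) (hmon : (finSuccEquiv k 1 F).Monic)
    (hω : evalAt ω F = 0) :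
    IsIntegral (MvPolynomial (Fin 1) k) ω ∧
      finSuccEquiv k 1 F ∣ minpoly (MvPolynomial (Fin 1) k) ω := by
  have hint : IsIntegral (MvPolynomial (Fin 1) k) ω := ⟨_, hmon, hω⟩
  refine ⟨hint, ?_⟩
  rcases ((MulEquiv.irreducible_iff (finSuccEquiv k 1)).2 hF).dvd_iff.1
    (minpoly.isIntegrallyClosed_dvd hint hω) with h | h
  · exact absurd h (minpoly.not_isUnit _ _)
  · exact h.dvd

theorem evalAt_eq_zero_iff (hF : Irreducible F) (hmon : (finSuccEquiv k 1 F).Monic)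
    (hω : evalAt ω F = 0) (p : PlanePoly k) : evalAt ω p = 0 ↔ F ∣ p := by
  obtain ⟨hint, hdvd⟩ := dvd_minpoly_of_evalAt_eq_zero hF hmon hω
  constructor
  · intro h
    have := hdvd.trans (minpoly.isIntegrallyClosed_dvd hint h)
    exact (map_dvd_iff (finSuccEquiv k 1)).1 this
  · intro h
    have := map_dvd (evalAt ω) h
    rwa [hω, zero_dvd_iff] at this

theorem degreeOf_zero_le_natDegree_minpoly (hF : Irreducible F)
    (hmon : (finSuccEquiv k 1 F).Monic) (hω : evalAt ω F = 0) :
    degreeOf 0 F ≤ (minpoly (FractionRing (MvPolynomial (Fin 1) k)) ω).natDegree := by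
  obtain ⟨hint, hdvd⟩ := dvd_minpoly_of_evalAt_eq_zero hF hmon hω
  rw [minpoly.isIntegrallyClosed_eq_field_fractions' (FractionRing (MvPolynomial (Fin 1) k)) hint,
    (minpoly.monic hint).natDegree_map, ← natDegree_finSuccEquiv]
  exact Polynomial.natDegree_le_of_dvd hdvd (minpoly.monic hint).ne_zero

theorem exists_evalAt_eq_zero (hmon : (finSuccEquiv k 1 F).Monic) (hd : degreeOf 0 F ≠ 0) :
    ∃ ω : RatClosure k, evalAt ω F = 0 := by
  obtain ⟨ω, hω⟩ := IsAlgClosed.exists_aeval_eq_zero_of_injective (RatClosure k)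
    (algebraMap_ratClosure_injective (k := k)) (finSuccEquiv k 1 F) (by
      rw [Polynomial.degree_eq_natDegree hmon.ne_zero, natDegree_finSuccEquiv]
      exact_mod_cast hd)
  exact ⟨ω, hω⟩

theorem transcendental_algebraMap_X :
    Transcendental k (algebraMap (MvPolynomial (Fin 1) k) (RatClosure k) (X 0)) :=
  (transcendental_algebraMap_iff algebraMap_ratClosure_injective).2 (transcendental_X k 0)

/-- The embedding of the function field of `Y` into an algebraic closure of `k(t)` given by a root
of the equation of `Y`. -/
theorem IrredPlaneSet.exists_embedding {Y : IrredPlaneSet k} (hY : Y.ideal = Ideal.span {F})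
    (hF : Irreducible F) (hmon : (finSuccEquiv k 1 F).Monic) (hω : evalAt ω F = 0) :
    ∃ ι : Y.FunctionField →+* RatClosure k, ∀ p : PlanePoly k,
      ι (algebraMap Y.CoordinateRing Y.FunctionField (Ideal.Quotient.mk Y.ideal p)) =
        evalAt ω p := by
  have hker : ∀ p, evalAt ω p = 0 ↔ p ∈ Y.ideal := fun p => by
    rw [evalAt_eq_zero_iff hF hmon hω, hY, Ideal.mem_span_singleton]
  let g : Y.CoordinateRing →+* RatClosure k :=
    Ideal.Quotient.lift Y.ideal (evalAt ω) fun p hp => (hker p).2 hp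
  have hg : Function.Injective g := by
    rw [injective_iff_map_eq_zero]
    intro q hq
    obtain ⟨p, rfl⟩ := Ideal.Quotient.mk_surjective q
    rw [Ideal.Quotient.lift_mk, hker] at hq
    exact Ideal.Quotient.eq_zero_iff_mem.2 hq
  refine ⟨IsFractionRing.lift hg, fun p => ?_⟩
  rw [IsFractionRing.lift_algebraMap, Ideal.Quotient.lift_mk]

end Embedding

/-! ### From itineraries to orbits at infinity -/

section Orbits

variable {k : Type*} [Field k]

/-- A polynomial in `x` and `t` as a rational function on `Y`. -/
noncomputable def IrredPlaneSet.toFunction (Y : IrredPlaneSet k) :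
    PlanePoly k →+* Y.FunctionField :=
  (algebraMap Y.CoordinateRing Y.FunctionField).comp (Ideal.Quotient.mk Y.ideal)

theorem IrredPlaneSet.IsCoefficientAction.apply_toFunction {Y : IrredPlaneSet k} {σ : k ≃+* k}
    {τ : Y.FunctionField ≃+* Y.FunctionField} (h : Y.IsCoefficientAction σ τ) (p : PlanePoly k) :
    τ (Y.toFunction p) = Y.toFunction (map (σ : k →+* k) p) := by
  have : (τ : Y.FunctionField →+* Y.FunctionField).comp Y.toFunction =
      Y.toFunction.comp (map (σ : k →+* k)) := by
    refine ringHom_ext (fun z => ?_) (fun i => ?_)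
    · rw [RingHom.comp_apply, RingHom.comp_apply, map_C]
      exact h.1 z
    · rw [RingHom.comp_apply, RingHom.comp_apply, map_X]
      exact h.2 i
  exact RingHom.congr_fun this p

/-- The point at infinity of `Y` cut out by an embedding of its function field into a field with a
valuation ring that contains the constants but not `t`. -/
noncomputable def IrredPlaneSet.pointOfEmbedding (Y : IrredPlaneSet k) {Ω : Type*} [Field Ω]
    (V : ValuationSubring Ω) (ι : Y.FunctionField →+* Ω)
    (hk : ∀ z : k, ι (algebraMap k Y.FunctionField z) ∈ V)
    (ht : ι (Y.toFunction (X 1)) ∉ V) : Y.PointAtInfinity :=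
  ⟨V.comap ι, hk, fun h => ht (h (Ideal.Quotient.mk Y.ideal (X 1)))⟩

/-- Choose one argument for each value of `f`; the hypothesis makes `g` injective on these choices.
Here `f` is the itinerary and `g` the orbit. -/
theorem exists_finset_card_eq_ncard {α β γ : Type*} (f : α → β) (g : α → γ)
    (hf : (Set.range f).Finite) (h : ∀ x y, g x = g y → f x = f y) :
    ∃ S : Finset γ, S.card = (Set.range f).ncard := by
  classical
  choose r hr using fun b : Set.range f => b.2
  have := hf.fintype
  refine ⟨Finset.univ.image fun b => g (r b), ?_⟩
  rw [Finset.card_image_of_injective, Finset.card_univ, ← Nat.card_eq_fintype_card,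
    Nat.card_coe_set_eq]
  intro b b' hb
  have := h _ _ hb
  rw [hr, hr] at this
  exact Subtype.ext this

/-- The point defined by `g` determines the itinerary of `g` through the functions `t / z j`, and so
does its orbit because these functions are invariant. The degree bound for the chain then applies to
`ω`. -/
theorem IrredPlaneSet.exists_orbits [CharZero k] {Y : IrredPlaneSet k}
    {F : PlanePoly k} (hY : Y.ideal = Ideal.span {F}) (hF : Irreducible F)
    (hmon : (finSuccEquiv k 1 F).Monic) (hd : degreeOf 0 F ≠ 0) {a c : k} {b : PlanePoly k}
    (hb : (a ≠ 0 ∧ b = C a) ∨ b = -X 1) {M : ℕ}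
    (hdvd : F ∣ (iteratePair c M).1 - b * (iteratePair c M).2) {L : Subfield k}
    (hL : ∀ σ : k ≃ₐ[L] k, σ c = c) :
    ∃ S : Finset (Y.OrbitsAtInfinity L), degreeOf 0 F ≤ 2 ^ S.card := by
  let R := MvPolynomial (Fin 1) k
  let K₀ := FractionRing R
  let Ω := RatClosure k
  obtain ⟨ω, hω⟩ := exists_evalAt_eq_zero hmon hd
  obtain ⟨ι, hι⟩ := IrredPlaneSet.exists_embedding hY hF hmon hω
  replace hι : ∀ p, ι (Y.toFunction p) = evalAt ω p := hι
  obtain ⟨V, hkV, htV⟩ := exists_valuationSubring_notMem (transcendental_algebraMap_X (k := k))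
  set t : Ω := algebraMap R Ω (X 0) with ht_def
  have hconst : ∀ a : k, algebraMap R Ω (C a) ∈ V := hkV
  have ht1 : 1 < V.valuation t := by
    rw [← not_le, V.valuation_le_one_iff]; exact htV
  -- Divisors of a nonzero constant are constants, and divisors of `-t` are constants or constant
  -- multiples of `t`.
  obtain ⟨β, hβ, hβ0, hβV⟩ : ∃ β : R, evalAt ω b = algebraMap R Ω β ∧ β ≠ 0 ∧
      ∀ r, r ∣ β → V.valuation (algebraMap R Ω r) ≤ V.valuation t := by
    have hle : ∀ x : k, V.valuation (algebraMap R Ω (C x)) ≤ 1 := fun x =>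
      (V.valuation_le_one_iff _).2 (hconst x)
    have hunit : ∀ r : R, IsUnit r → V.valuation (algebraMap R Ω r) ≤ 1 := by
      intro r hr
      obtain ⟨x, _, rfl⟩ := isUnit_iff_eq_C_of_isReduced.1 hr
      exact hle x
    rcases hb with ⟨ha, rfl⟩ | rfl
    · refine ⟨C a, evalAt_C ω a, by simpa using ha, fun r hr => (hunit r ?_).trans ht1.le⟩
      exact isUnit_of_dvd_unit hr ((isUnit_iff_ne_zero.2 ha).map C)
    · refine ⟨-X 0, by rw [map_neg, map_neg, evalAt_X_one], neg_ne_zero.2 (X_ne_zero 0), ?_⟩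
      intro r hr
      rw [dvd_neg] at hr
      rcases (X_prime (i := (0 : Fin 1)) (R := k)).irreducible.dvd_iff.1 hr with h | ⟨u, hu⟩
      · exact (hunit r h).trans ht1.le
      · have : r = X 0 * (↑u : R) := hu.symm
        rw [this, map_mul, map_mul]
        exact mul_le_of_le_one_right' (hunit _ u.isUnit)
  -- If `F` divided the denominator it would also divide the numerator, against coprimality.
  have hQ : evalAt ω (iteratePair c M).2 ≠ 0 := by
    rw [Ne, evalAt_eq_zero_iff hF hmon hω]
    intro h
    refine hF.not_isUnit (isRelPrime_iteratePair c M ?_ h)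
    exact (dvd_sub_left (h.mul_left _)).1 hdvd
  have hP : evalAt ω (iteratePair c M).1 = algebraMap R Ω β * evalAt ω (iteratePair c M).2 := by
    rw [← hβ, ← map_mul, ← sub_eq_zero, ← map_sub, evalAt_eq_zero_iff hF hmon hω]
    exact hdvd
  have hchain := isPreimageChain_of_eq (evalAt ω) hQ hP
  rw [evalAt_C, evalAt_X_one] at hchain
  set z : ℕ → Ω := fun i => evalAt ω (iteratePair c (M - i)).1 / evalAt ω (iteratePair c (M - i)).2
    with hz
  have hdeg := hchain.natDegree_minpoly_le (K₀ := K₀) ht1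
    ((V.valuation_le_one_iff _).2 (hconst c)) hβV M le_rfl
  have hzM : z M = ω := by
    simp [hz, iteratePair, evalAt_X_zero]
  rw [hzM] at hdeg
  have hfix : ∀ (g : Ω ≃ₐ[K₀] Ω) (r : R), g (algebraMap R Ω r) = algebraMap R Ω r := by
    intro g r
    rw [IsScalarTower.algebraMap_apply R K₀ Ω, g.commutes]
  let pt : (Ω ≃ₐ[K₀] Ω) → Y.PointAtInfinity := fun g =>
    Y.pointOfEmbedding V ((g : Ω →+* Ω).comp ι)
      (fun x => by
        have : algebraMap k Y.FunctionField x = Y.toFunction (C x) := rfl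
        rw [RingHom.comp_apply, this, hι, evalAt_C]
        exact (hfix g (C x)).symm ▸ hconst x)
      (by
        rw [RingHom.comp_apply, hι, evalAt_X_one]
        exact fun h => htV ((congrArg (· ∈ V) (hfix g (X 0))).mp h))
  have hzne : ∀ j ≤ M, z j ≠ 0 := hchain.ne_zero
    ((map_ne_zero_iff _ algebraMap_ratClosure_injective).2 hβ0)
  -- The function `t / z j` on `Y`; since `z j ≠ 0`, it is regular at the point of `g` exactly when
  -- `v t ≤ v (g (z j))`.
  let f : ℕ → Y.FunctionField := fun j => Y.toFunction (X 1) /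
    (Y.toFunction (iteratePair c (M - j)).1 / Y.toFunction (iteratePair c (M - j)).2)
  have hf : ∀ j, ι (f j) = t / z j := fun j => by
    simp only [f, map_div₀, hι, evalAt_X_one]
    rfl
  have hmem : ∀ g, ∀ j ≤ M, f j ∈ (pt g).1 ↔ V.valuation t ≤ V.valuation (g (z j)) := by
    intro g j hj
    change g (ι (f j)) ∈ V ↔ _
    rw [hf, ← V.valuation_le_one_iff, map_div₀, map_div₀, hfix]
    refine div_le_one₀ ?_
    rw [zero_lt_iff, Valuation.ne_zero_iff]
    exact (map_ne_zero_iff g g.injective).2 (hzne j hj)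
  obtain ⟨S, hS⟩ := exists_finset_card_eq_ncard
    (itinerary (G := Ω ≃ₐ[K₀] Ω) V.valuation t z M)
    (fun g => (Quotient.mk (Y.infinitySetoid L) (pt g) : Y.OrbitsAtInfinity L))
    (finite_range_itinerary _ _ _ _) (by
      intro g h hgh
      obtain ⟨σ, τ, hact, hiff⟩ := Quotient.exact hgh
      have hσ : (σ.toRingEquiv : k →+* k) c = c := hL σ
      -- The coefficients of `f j` involve only `c`, which `σ` fixes.
      have hτ : ∀ j, τ (f j) = f j := fun j => by
        simp only [f, map_div₀, hact.apply_toFunction, map_X,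
          (map_iteratePair (σ.toRingEquiv : k →+* k) c _).1,
          (map_iteratePair (σ.toRingEquiv : k →+* k) c _).2, hσ]
      ext j
      refine and_congr_right fun hj => ?_
      rw [← hmem g j hj, ← hmem h j hj, ← hiff, hτ])
  exact ⟨S, hS ▸ (degreeOf_zero_le_natDegree_minpoly hF hmon hω).trans hdeg⟩

end Orbits

/-! ### Normalizing the equation and concluding -/

section Normalization

variable {k : Type*} [Field k]

theorem exists_associated_monic {F G : PlanePoly k} (hG : (finSuccEquiv k 1 G).Monic)
    (h : F ∣ G) : ∃ F', Associated F F' ∧ (finSuccEquiv k 1 F').Monic := by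
  obtain ⟨H, rfl⟩ := h
  rw [map_mul] at hG
  have hu : IsUnit (finSuccEquiv k 1 F).leadingCoeff := by
    have := hG.leadingCoeff
    rw [Polynomial.leadingCoeff_mul] at this
    exact IsUnit.of_mul_eq_one _ this
  obtain ⟨u, hu0, hu⟩ := isUnit_iff_eq_C_of_isReduced.1 hu
  have hC : ∀ s : k, finSuccEquiv k 1 (C s) = Polynomial.C (C s) := fun s => by
    rw [finSuccEquiv_apply, eval₂Hom_C]; rfl
  refine ⟨F * C u⁻¹, associated_mul_unit_right F _ (hu0.inv.map C), ?_⟩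
  rw [Polynomial.Monic, map_mul, Polynomial.leadingCoeff_mul, hu, hC, Polynomial.leadingCoeff_C,
    ← C_mul, mul_inv_cancel₀ hu0.ne_zero, C_1]

theorem exists_coeff_eq_one {F : PlanePoly k} (hF : (finSuccEquiv k 1 F).Monic) :
    ∃ m, coeff m F = 1 := by
  refine ⟨Finsupp.cons (finSuccEquiv k 1 F).natDegree 0, ?_⟩
  rw [← finSuccEquiv_coeff_coeff, Polynomial.coeff_natDegree, hF.leadingCoeff, coeff_zero_one]

end Normalization

end PreimageCurves

theorem theorem4p11 {K Kbar : Type*} [Field K] [NumberField K] [Field Kbar] [Algebra K Kbar]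
    [IsAlgClosure K Kbar] (a c : K) (N : ℕ) (hN : 1 ≤ N)
    (Y : PreimageCurves.IrredPlaneSet Kbar)
    (hY : Y.IsComponentOf
      (PreimageCurves.Ypre (algebraMap K Kbar a) (algebraMap K Kbar c) N)) :
    -- `L` is the minimal field of definition of `Y`, and `F = 0` is the equation of `Y`
    ∃ (L : Subfield Kbar) (F : MvPolynomial (Fin 2) Kbar),
      IsLeast {M : Subfield Kbar | Y.IsDefinedOver M} L ∧
      Y.ideal = Ideal.span {F} ∧
      ∃ S : Finset (Y.OrbitsAtInfinity L),
        Real.logb 2 (F.degreeOf 0 : ℝ) ≤ (S.card : ℝ) := by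
  open PreimageCurves MvPolynomial in
  have : IsAlgClosed Kbar := IsAlgClosure.isAlgClosed K
  have : CharZero Kbar := charZero_of_injective_algebraMap (algebraMap K Kbar).injective
  generalize algebraMap K Kbar a = a at hY
  generalize algebraMap K Kbar c = c at hY
  have hG := monic_finSuccEquiv_sub a c N
  have hG0 : (iteratePair c N).1 - C a * (iteratePair c N).2 ≠ 0 := fun h => by
    rw [h, map_zero] at hG
    exact hG.ne_zero rfl
  obtain ⟨F₀, hF₀, hdvd₀, hY₀⟩ := hY.exists_ideal_eq_span hG0
  obtain ⟨F, hassoc, hmon⟩ := exists_associated_monic hG hdvd₀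
  have hF : Irreducible F := hassoc.irreducible hF₀
  have hdvd := hassoc.symm.dvd.trans hdvd₀
  have hYF : Y.ideal = Ideal.span {F} := by
    rw [hY₀, Ideal.span_singleton_eq_span_singleton]
    exact hassoc
  obtain ⟨m, hm⟩ := exists_coeff_eq_one hmon
  refine ⟨coeffField F, F, IrredPlaneSet.isLeast_coeffField hYF hm, hYF, ?_⟩
  by_cases hd : 2 ≤ degreeOf 0 F
  · obtain ⟨n, b, hb, hdvd'⟩ := exists_base_point hF hd hdvd
    obtain ⟨S, hS⟩ := IrredPlaneSet.exists_orbits hYF hF hmon (by omega) hb hdvd'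
      (L := coeffField F) fun σ =>
        apply_eq_self_of_map_eq hF hd hb hdvd' (map_eq_self_of_coeffField σ)
    refine ⟨S, ?_⟩
    rw [Real.logb_le_iff_le_rpow one_lt_two (by exact_mod_cast (by omega : 0 < degreeOf 0 F)),
      Real.rpow_natCast]
    exact_mod_cast hS
  -- In degree at most one the logarithm is `0` (with `Real.logb 2 0 = 0`), so no orbit is needed.
  · refine ⟨∅, ?_⟩
    have : degreeOf 0 F = 0 ∨ degreeOf 0 F = 1 := by omega
    rcases this with h | h <;> simp [h]
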